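/- **Matryoshka theorem.** Let $\mathfrak g$ be one of the complex Lie superalgebras $\mathfrak{sl}(m|n)$ ($m,n\ge 1$, $m\ne n$) or $\mathfrak{osp}(2|2n)$ ($n\ge 1$). Its even part is $\mathfrak g_{ss}\oplus\mathbb C Y$, where $\mathfrak g_{ss}=\mathfrak{sl}(m)\oplus\mathfrak{sl}(n)$, respectively $\mathfrak{sp}(2n)$, and the hypercharge $Y$ centralizes the even part; its odd part is $\mathfrak g_{1}\oplus\mathfrak g_{-1}$ with $[Y,u]=u$ for the odd raising elements $u\in\mathfrak g_1$ and $[Y,v]=-v$ for the odd lowering elements $v\in\mathfrak g_{-1}$. Let $L$ be a finite-dimensional irreducible $\mathfrak g_{ss}$-module. For $y\in\mathbb C$ let $L_y$ be $L$ with $Y$ acting as the scalar $y$ and $\mathfrak g_1$ acting as zero, and let $$K(L,y)=U(\mathfrak g)\otimes_{U(\mathfrak g_{ss}\oplus\mathbb CY\oplus\mathfrak g_1)}L_y$$ be the Kac module (typical or atypical; no quotient by proper submodules is taken). Fix a nonzero $\Lambda\in L$, for example a highest weight vector. 1. There are $D\in\mathbb N$, elements $c_1,\dots,c_D$ of the subalgebra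 of $U(\mathfrak g)$ generated by $\mathfrak g_{ss}$ and $\mathfrak g_{-1}$, and integers $p_j\ge 0$ with $[Y,c_j]=-p_jc_j$, such that for every $y\in\mathbb C$ the vectors $c_1\Lambda,\dots,c_D\Lambda$ form a basis of $K(L,y)$. 2. Take any $D$, $c_j$, $p_j$ as in 1, and let $\rho_y(x)$ be the matrix of $x\in\mathfrak g$ on $K(L,y)$ in this basis. Then the entries of $\rho_y(x)$ are differentiable in $y\in\mathbb C$, and the derivative $\rho'(x)=\partial_y\rho_y(x)$ does not depend on $y$. Moreover $\rho'(\mu)=0$ for $\mu\in\mathfrak g_{ss}$, $\rho'(v)=0$ for $v\in\mathfrak g_{-1}$ and $\rho'(Y)=I$. Write $u'=\rho'(u)$ for $u\in\mathfrak g_1$. 3. Let $y\in\mathbb C$, $N\ge1$ and $\lambda=(\lambda_1,\dots,\lambda_{N-1})\in\mathbb C^{N-1}$. For $x\in\mathfrak g$ let $R_\lambda(x)$ be the $N\times N$ block matrix with all diagonal blocks equal to $\rho_y(x)$, with block $\lambda_i\,\rho'(x)$ at the place $(i,i+1)$, and with all other blocks zero. Thus $\mu\in\mathfrak g_{ss}$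 and $v\in\mathfrak g_{-1}$ are sent to block diagonal matrices $M$ and $V$; $Y$ is sent to a matrix with blocks $\rho_y(Y)$ on the diagonal and $\lambda_iI$ above it; and $u\in\mathfrak g_1$ is sent to a matrix $U$ with blocks $\rho_y(u)$ on the diagonal and $\lambda_iu'$ above it. Then: * the matrices $R_\lambda(x)$ have size $N\cdot\dim K(L,y)$ and form a representation of the Lie superalgebra $\mathfrak g$, the $j$-th basis vector of each block having parity $p_j \bmod 2$; * if $F_k$ is the space of vectors supported on the first $k$ blocks, then $0=F_0\subset F_1\subset\dots\subset F_N$ are subrepresentations and $F_{k+1}/F_k\cong K(L,y)$ as $\mathfrak g$-modules for $0\le k<N$; * if all $\lambda_i\neq0$, then $R_\lambda$ is indecomposable: the space is nonzero and is not a direct sum of two nonzero invariant subspaces; * if all $\lambda_i$ and all $\lambda'_i$ are nonzero, there are nonzero scalars $s_1,\dots,s_N$ such that the block diagonal matrix $Q=\mathrm{diag}(s_1I,\dots,s_NI)$ satisfies $Q\,R_\lambda(x)\,Q^{-1}=R_{\lambda'}(x)$ for all $x\in\mathfrak g$. -/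

import Mathlib

open scoped TensorProduct

attribute [local instance] LieRing.ofAssociativeRing LieAlgebra.ofAssociativeAlgebra

/-! ### Matrices graded by a parity function on the index set -/

namespace Matryoshka

/-- The even part of a square matrix whose index set carries a parity `ε`. -/
def evenPart {ι : Type} (ε : ι → ZMod 2) : Matrix ι ι ℂ →ₗ[ℂ] Matrix ι ι ℂ where
  toFun X := Matrix.of fun i j => if ε i = ε j then X i j else 0
  map_add' X Y := by
    ext i j
    by_cases h : ε i = ε j <;> simp [h]
  map_smul' c X := by
    ext i j
    by_cases h : ε i = ε j <;> simp [h]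

/-- The odd part of a square matrix whose index set carries a parity `ε`. -/
def oddPart {ι : Type} (ε : ι → ZMod 2) : Matrix ι ι ℂ →ₗ[ℂ] Matrix ι ι ℂ :=
  LinearMap.id - evenPart ε

/-- Even matrices: they preserve the parity. -/
def IsEven {ι : Type} (ε : ι → ZMod 2) (X : Matrix ι ι ℂ) : Prop :=
  ∀ i j, ε i ≠ ε j → X i j = 0

/-- Odd matrices: they exchange the two parities. -/
def IsOdd {ι : Type} (ε : ι → ZMod 2) (X : Matrix ι ι ℂ) : Prop :=
  ∀ i j, ε i = ε j → X i j = 0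

section facts

variable {ι : Type} {ε : ι → ZMod 2}

theorem evenPart_apply (X : Matrix ι ι ℂ) (i j : ι) :
    evenPart ε X i j = if ε i = ε j then X i j else 0 := rfl

theorem oddPart_apply (X : Matrix ι ι ℂ) (i j : ι) :
    oddPart ε X i j = if ε i = ε j then 0 else X i j := by
  simp only [oddPart, LinearMap.sub_apply, LinearMap.id_apply, Matrix.sub_apply, evenPart_apply]
  split_ifs <;> simp

theorem isEven_evenPart (X : Matrix ι ι ℂ) : IsEven ε (evenPart ε X) := by
  intro i j h
  simp [evenPart_apply, h]

theorem isOdd_oddPart (X : Matrix ι ι ℂ) : IsOdd ε (oddPart ε X) := by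
  intro i j h
  simp [oddPart_apply, h]

theorem evenPart_of_isEven {X : Matrix ι ι ℂ} (h : IsEven ε X) : evenPart ε X = X := by
  ext i j
  rw [evenPart_apply]
  split_ifs with e
  · rfl
  · exact (h i j e).symm

theorem evenPart_of_isOdd {X : Matrix ι ι ℂ} (h : IsOdd ε X) : evenPart ε X = 0 := by
  ext i j
  rw [evenPart_apply]
  split_ifs with e
  · exact h i j e
  · rfl

theorem oddPart_of_isEven {X : Matrix ι ι ℂ} (h : IsEven ε X) : oddPart ε X = 0 := by
  simp [oddPart, evenPart_of_isEven h]

theorem oddPart_of_isOdd {X : Matrix ι ι ℂ} (h : IsOdd ε X) : oddPart ε X = X := by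
  simp [oddPart, evenPart_of_isOdd h]

theorem evenPart_add_oddPart (X : Matrix ι ι ℂ) : evenPart ε X + oddPart ε X = X := by
  simp [oddPart]

theorem IsEven.add {X Y : Matrix ι ι ℂ} (hX : IsEven ε X) (hY : IsEven ε Y) :
    IsEven ε (X + Y) := fun i j h => by simp [hX i j h, hY i j h]

theorem IsEven.sub {X Y : Matrix ι ι ℂ} (hX : IsEven ε X) (hY : IsEven ε Y) :
    IsEven ε (X - Y) := fun i j h => by simp [hX i j h, hY i j h]

theorem IsEven.smul (c : ℂ) {X : Matrix ι ι ℂ} (hX : IsEven ε X) :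
    IsEven ε (c • X) := fun i j h => by simp [hX i j h]

theorem IsOdd.sub {X Y : Matrix ι ι ℂ} (hX : IsOdd ε X) (hY : IsOdd ε Y) :
    IsOdd ε (X - Y) := fun i j h => by simp [hX i j h, hY i j h]

variable [Fintype ι]

theorem IsEven.mul {X Y : Matrix ι ι ℂ} (hX : IsEven ε X) (hY : IsEven ε Y) :
    IsEven ε (X * Y) := by
  intro i j h
  rw [Matrix.mul_apply]
  refine Finset.sum_eq_zero fun k _ => ?_
  by_cases hk : ε i = ε k
  · rw [hY k j (fun e => h (hk.trans e)), mul_zero]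
  · rw [hX i k hk, zero_mul]

theorem IsEven.mul_odd {X Y : Matrix ι ι ℂ} (hX : IsEven ε X) (hY : IsOdd ε Y) :
    IsOdd ε (X * Y) := by
  intro i j h
  rw [Matrix.mul_apply]
  refine Finset.sum_eq_zero fun k _ => ?_
  by_cases hk : ε i = ε k
  · rw [hY k j (hk.symm.trans h), mul_zero]
  · rw [hX i k hk, zero_mul]

theorem IsOdd.mul_even {X Y : Matrix ι ι ℂ} (hX : IsOdd ε X) (hY : IsEven ε Y) :
    IsOdd ε (X * Y) := by
  intro i j h
  rw [Matrix.mul_apply]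
  refine Finset.sum_eq_zero fun k _ => ?_
  by_cases hk : ε i = ε k
  · rw [hX i k hk, zero_mul]
  · rw [hY k j (fun e => hk (h.trans e.symm)), mul_zero]

theorem IsOdd.mul {X Y : Matrix ι ι ℂ} (hX : IsOdd ε X) (hY : IsOdd ε Y) :
    IsEven ε (X * Y) := by
  intro i j h
  rw [Matrix.mul_apply]
  refine Finset.sum_eq_zero fun k _ => ?_
  by_cases hk : ε i = ε k
  · rw [hX i k hk, zero_mul]
  · have two : ∀ a b c : ZMod 2, a ≠ b → a ≠ c → c = b := by decide
    rw [hY k j (two _ _ _ h hk), mul_zero]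

theorem evenPart_comm {X : Matrix ι ι ℂ} (hX : IsEven ε X) (Z : Matrix ι ι ℂ) :
    evenPart ε (X * Z - Z * X) = X * evenPart ε Z - evenPart ε Z * X := by
  have key : X * Z - Z * X = (X * evenPart ε Z - evenPart ε Z * X)
      + (X * oddPart ε Z - oddPart ε Z * X) := by
    conv_lhs => rw [← evenPart_add_oddPart (ε := ε) Z]
    noncomm_ring
  rw [key, map_add,
    evenPart_of_isEven ((hX.mul (isEven_evenPart Z)).sub ((isEven_evenPart Z).mul hX)),
    evenPart_of_isOdd ((hX.mul_odd (isOdd_oddPart Z)).sub ((isOdd_oddPart Z).mul_even hX)),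
    add_zero]

theorem oddPart_comm {X : Matrix ι ι ℂ} (hX : IsEven ε X) (Z : Matrix ι ι ℂ) :
    oddPart ε (X * Z - Z * X) = X * oddPart ε Z - oddPart ε Z * X := by
  simp only [oddPart, LinearMap.sub_apply, LinearMap.id_apply, evenPart_comm hX]
  noncomm_ring

end facts

/-! ### Lie superalgebras of matrices graded by a hypercharge -/

/-- A complex Lie superalgebra of matrices (a Lie sub-superalgebra of `𝔤𝔩(idx, parity)`), with
even part `ss ⊕ ℂ Y`, where the hypercharge `Y` centralizes the even part and has eigenvalues
`1` and `-1` on the odd part. The superbracket is the commutator of matrices if one argument is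
even, and the anticommutator if both are odd. -/
structure HyperSuperalgebra where
  idx : Type
  [fintypeIdx : Fintype idx]
  [decEqIdx : DecidableEq idx]
  parity : idx → ZMod 2
  carrier : Submodule ℂ (Matrix idx idx ℂ)
  evenPart_mem : ∀ X ∈ carrier, evenPart parity X ∈ carrier
  comm_mem : ∀ X ∈ carrier, IsEven parity X → ∀ Z ∈ carrier, X * Z - Z * X ∈ carrier
  anticomm_mem : ∀ X ∈ carrier, IsOdd parity X → ∀ Z ∈ carrier, IsOdd parity Z →
    X * Z + Z * X ∈ carrier
  /-- the hypercharge `Y` -/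
  Y : carrier
  /-- the semisimple part of the even subalgebra -/
  ss : LieSubalgebra ℂ (Matrix idx idx ℂ)
  ss_mem : ∀ X ∈ ss, X ∈ carrier
  ss_even : ∀ X ∈ ss, IsEven parity X
  Y_even : IsEven parity (Y : Matrix idx idx ℂ)
  Y_comm : ∀ X ∈ carrier, IsEven parity X → (Y : Matrix idx idx ℂ) * X = X * Y
  even_decomp : ∀ X ∈ carrier, IsEven parity X →
    ∃ S ∈ ss, ∃ t : ℂ, X = S + t • (Y : Matrix idx idx ℂ)
  Y_notMem : (Y : Matrix idx idx ℂ) ∉ ss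
  odd_decomp : ∀ X ∈ carrier, IsOdd parity X → ∃ U ∈ carrier, ∃ V ∈ carrier,
    IsOdd parity U ∧ IsOdd parity V ∧ (Y : Matrix idx idx ℂ) * U - U * Y = U ∧
    (Y : Matrix idx idx ℂ) * V - V * Y = -V ∧ X = U + V

attribute [instance] HyperSuperalgebra.fintypeIdx HyperSuperalgebra.decEqIdx

namespace HyperSuperalgebra

variable (G : HyperSuperalgebra)

/-- An even element of the superalgebra. -/
def Even (x : G.carrier) : Prop := IsEven G.parity (x : Matrix G.idx G.idx ℂ)

/-- An odd element of the superalgebra. -/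
def Odd (x : G.carrier) : Prop := IsOdd G.parity (x : Matrix G.idx G.idx ℂ)

/-- The bracket `[x, z]` of an even element with any element. -/
def comm (x z : G.carrier) (hx : G.Even x) : G.carrier :=
  ⟨(x : Matrix G.idx G.idx ℂ) * z - z * x, G.comm_mem x x.2 hx z z.2⟩

/-- The bracket `{x, z}` of two odd elements. -/
def anticomm (x z : G.carrier) (hx : G.Odd x) (hz : G.Odd z) : G.carrier :=
  ⟨(x : Matrix G.idx G.idx ℂ) * z + z * x, G.anticomm_mem x x.2 hx z z.2 hz⟩

/-- The odd raising generators `u`: odd elements of hypercharge `1`. -/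
def IsRaising (x : G.carrier) : Prop :=
  G.Odd x ∧ (G.Y : Matrix G.idx G.idx ℂ) * x - x * G.Y = x

/-- The odd lowering generators `v`: odd elements of hypercharge `-1`. -/
def IsLowering (x : G.carrier) : Prop :=
  G.Odd x ∧ (G.Y : Matrix G.idx G.idx ℂ) * x - x * G.Y = -x

/-- An element of the semisimple even part, seen in the superalgebra. -/
def ofSS (x : G.ss) : G.carrier := ⟨x, G.ss_mem x x.2⟩

/-! ### The enveloping superalgebra and the Kac modules -/

/-- The defining relations of the enveloping algebra. The bracket of an odd with an even element
is covered as well, since it is minus the bracket of the even with the odd one. -/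
inductive EnvRel : TensorAlgebra ℂ G.carrier → TensorAlgebra ℂ G.carrier → Prop
  | even (x z : G.carrier) (hx : G.Even x) :
      EnvRel (TensorAlgebra.ι ℂ (G.comm x z hx))
        (TensorAlgebra.ι ℂ x * TensorAlgebra.ι ℂ z - TensorAlgebra.ι ℂ z * TensorAlgebra.ι ℂ x)
  | odd (x z : G.carrier) (hx : G.Odd x) (hz : G.Odd z) :
      EnvRel (TensorAlgebra.ι ℂ (G.anticomm x z hx hz))
        (TensorAlgebra.ι ℂ x * TensorAlgebra.ι ℂ z + TensorAlgebra.ι ℂ z * TensorAlgebra.ι ℂ x)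

/-- The universal enveloping algebra of the Lie superalgebra. -/
def Env : Type := RingQuot G.EnvRel

noncomputable instance : Ring G.Env := inferInstanceAs (Ring (RingQuot G.EnvRel))

noncomputable instance : Algebra ℂ G.Env := inferInstanceAs (Algebra ℂ (RingQuot G.EnvRel))

/-- The canonical map of the superalgebra to its enveloping algebra. -/
noncomputable def env : G.carrier →ₗ[ℂ] G.Env :=
  (RingQuot.mkAlgHom ℂ G.EnvRel).toLinearMap ∘ₗ TensorAlgebra.ι ℂ

/-- The subalgebra of the enveloping algebra generated by the semisimple even part and by the odd
lowering generators. -/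
noncomputable def lowerEnv : Subalgebra ℂ G.Env :=
  Algebra.adjoin ℂ {a | (∃ x : G.ss, a = G.env (G.ofSS x)) ∨
    ∃ v : G.carrier, G.IsLowering v ∧ a = G.env v}

variable (L : Type*) [AddCommGroup L] [Module ℂ L] [LieRingModule G.ss L] [LieModule ℂ G.ss L]

/-- The relations that identify, in `U(𝔤) ⊗ L`, the action of the semisimple even part with its
action on `L`, the action of the hypercharge on `L` with the scalar `y`, and the action of the odd
raising generators on `L` with zero. -/
noncomputable def kacRel (y : ℂ) : Submodule G.Env (G.Env ⊗[ℂ] L) :=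
  Submodule.span G.Env {t |
    (∃ (x : G.ss) (l : L), t = G.env (G.ofSS x) ⊗ₜ[ℂ] l - (1 : G.Env) ⊗ₜ[ℂ] ⁅x, l⁆) ∨
    (∃ l : L, t = G.env G.Y ⊗ₜ[ℂ] l - (1 : G.Env) ⊗ₜ[ℂ] (y • l)) ∨
    (∃ (u : G.carrier) (l : L), G.IsRaising u ∧ t = G.env u ⊗ₜ[ℂ] l)}

/-- The Kac module `K(L, y)`: the `𝔤`-module induced from `L`, on which the hypercharge acts as the
scalar `y` and the odd raising generators act as zero, i.e. `U(𝔤) ⊗ L` over the enveloping algebra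
of the subalgebra spanned by the even part and by the odd raising generators. -/
abbrev Kac (y : ℂ) : Type _ := (G.Env ⊗[ℂ] L) ⧸ G.kacRel L y

/-- The image of `1 ⊗ l` in the Kac module. -/
noncomputable def top (y : ℂ) (l : L) : G.Kac L y :=
  (G.kacRel L y).mkQ ((1 : G.Env) ⊗ₜ[ℂ] l)

/-- The action of the superalgebra on the Kac module. -/
noncomputable def act (y : ℂ) : G.carrier →ₗ[ℂ] Module.End ℂ (G.Kac L y) :=
  (Algebra.lsmul ℂ ℂ (G.Kac L y)).toLinearMap ∘ₗ G.env

/-- The matrices of the Kac module in a basis. -/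
noncomputable def kacMatrix (y : ℂ) {D : ℕ} (b : Module.Basis (Fin D) ℂ (G.Kac L y)) :
    G.carrier →ₗ[ℂ] Matrix (Fin D) (Fin D) ℂ :=
  (LinearMap.toMatrix b b).toLinearMap ∘ₗ G.act L y

/-! ### Matrix representations -/

/-- `R` is a representation of the superalgebra on the superspace with basis `κ` and parity `ε`. -/
structure IsRep {κ : Type} [Fintype κ] (ε : κ → ZMod 2)
    (R : G.carrier →ₗ[ℂ] Matrix κ κ ℂ) : Prop where
  even : ∀ x, G.Even x → IsEven ε (R x)
  odd : ∀ x, G.Odd x → IsOdd ε (R x)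
  map_comm : ∀ x z (hx : G.Even x), R (G.comm x z hx) = R x * R z - R z * R x
  map_anticomm : ∀ x z (hx : G.Odd x) (hz : G.Odd z),
    R (G.anticomm x z hx hz) = R x * R z + R z * R x

/-- The subspace `W` is stable under all the matrices `R x`. -/
def IsInvariant {κ : Type} [Fintype κ] (R : G.carrier →ₗ[ℂ] Matrix κ κ ℂ)
    (W : Submodule ℂ (κ → ℂ)) : Prop :=
  ∀ x, ∀ w ∈ W, (R x).mulVec w ∈ W

/-- `R` acts on a nonzero space that is not a direct sum of two nonzero invariant subspaces. -/
def IsIndecomposable {κ : Type} [Fintype κ] (R : G.carrier →ₗ[ℂ] Matrix κ κ ℂ) : Prop :=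
  Nonempty κ ∧ ∀ W₁ W₂ : Submodule ℂ (κ → ℂ), G.IsInvariant R W₁ → G.IsInvariant R W₂ →
    IsCompl W₁ W₂ → W₁ = ⊥ ∨ W₂ = ⊥

end HyperSuperalgebra

/-! ### Nested block matrices -/

/-- The `N × N` block matrix with `A` on the diagonal, `lam i • B` at the place `(i, i + 1)`, and
zero elsewhere. -/
def nest {N D : ℕ} (lam : Fin (N - 1) → ℂ) (A B : Matrix (Fin D) (Fin D) ℂ) :
    Matrix (Fin N × Fin D) (Fin N × Fin D) ℂ :=
  Matrix.of fun p q =>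
    if p.1 = q.1 then A p.2 q.2
    else if h : p.1.val + 1 = q.1.val then lam ⟨p.1.val, by have := q.1.isLt; omega⟩ * B p.2 q.2
    else 0

/-- The map `x ↦ nest lam (ρ x) (ρ' x)`. -/
def nestMap {V : Type*} [AddCommGroup V] [Module ℂ V] {N D : ℕ} (lam : Fin (N - 1) → ℂ)
    (ρ ρ' : V →ₗ[ℂ] Matrix (Fin D) (Fin D) ℂ) :
    V →ₗ[ℂ] Matrix (Fin N × Fin D) (Fin N × Fin D) ℂ where
  toFun x := nest lam (ρ x) (ρ' x)
  map_add' x z := by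
    ext p q
    simp only [nest, map_add, Matrix.of_apply, Matrix.add_apply]
    split_ifs <;> ring
  map_smul' c x := by
    ext p q
    simp only [nest, map_smul, Matrix.of_apply, Matrix.smul_apply, smul_eq_mul, RingHom.id_apply]
    split_ifs <;> ring

/-- The vectors supported on the first `k` blocks. -/
def flag (N D k : ℕ) : Submodule ℂ (Fin N × Fin D → ℂ) where
  carrier := {w | ∀ p : Fin N × Fin D, k ≤ p.1.val → w p = 0}
  add_mem' hv hw p hp := by simp [hv p hp, hw p hp]
  zero_mem' _ _ := rfl
  smul_mem' c w hw p hp := by simp [hw p hp]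


/-! ### The superalgebras `𝔰𝔩(m|n)` and `𝔬𝔰𝔭(2|2n)` -/

/-- The parity of the index set of `ℂ^(α|β)`. -/
def parityOf (α β : Type) : α ⊕ β → ZMod 2 := Sum.elim (fun _ => 0) (fun _ => 1)

section blocks

variable {α β : Type}

theorem evenPart_fromBlocks (A : Matrix α α ℂ) (B : Matrix α β ℂ) (C : Matrix β α ℂ)
    (E : Matrix β β ℂ) :
    evenPart (parityOf α β) (Matrix.fromBlocks A B C E) = Matrix.fromBlocks A 0 0 E := by
  ext i j
  rcases i with i | i <;> rcases j with j | j <;> simp [evenPart_apply, parityOf]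

theorem isEven_fromBlocks (A : Matrix α α ℂ) (E : Matrix β β ℂ) :
    IsEven (parityOf α β) (Matrix.fromBlocks A 0 0 E) := by
  intro i j h
  rcases i with i | i <;> rcases j with j | j <;> simp [parityOf] at h ⊢

theorem isOdd_fromBlocks (B : Matrix α β ℂ) (C : Matrix β α ℂ) :
    IsOdd (parityOf α β) (Matrix.fromBlocks 0 B C 0) := by
  intro i j h
  rcases i with i | i <;> rcases j with j | j <;> simp [parityOf] at h ⊢

theorem IsEven.blocks {X : Matrix (α ⊕ β) (α ⊕ β) ℂ} (h : IsEven (parityOf α β) X) :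
    X = Matrix.fromBlocks X.toBlocks₁₁ 0 0 X.toBlocks₂₂ := by
  conv_lhs => rw [← evenPart_of_isEven h, ← Matrix.fromBlocks_toBlocks X, evenPart_fromBlocks]

theorem IsOdd.blocks {X : Matrix (α ⊕ β) (α ⊕ β) ℂ} (h : IsOdd (parityOf α β) X) :
    X = Matrix.fromBlocks 0 X.toBlocks₁₂ X.toBlocks₂₁ 0 := by
  ext i j
  rcases i with i | i <;> rcases j with j | j <;>
    first
    | exact h _ _ rfl
    | rfl

theorem toBlocks_lie [Fintype α] [Fintype β] {X Z : Matrix (α ⊕ β) (α ⊕ β) ℂ}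
    (hX : X.toBlocks₁₂ = 0 ∧ X.toBlocks₂₁ = 0) (hZ : Z.toBlocks₁₂ = 0 ∧ Z.toBlocks₂₁ = 0) :
    X * Z - Z * X = Matrix.fromBlocks
      (X.toBlocks₁₁ * Z.toBlocks₁₁ - Z.toBlocks₁₁ * X.toBlocks₁₁) 0 0
      (X.toBlocks₂₂ * Z.toBlocks₂₂ - Z.toBlocks₂₂ * X.toBlocks₂₂) := by
  conv_lhs => rw [← Matrix.fromBlocks_toBlocks X, ← Matrix.fromBlocks_toBlocks Z,
    hX.1, hX.2, hZ.1, hZ.2]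
  simp [Matrix.fromBlocks_multiply, sub_eq_add_neg, Matrix.fromBlocks_neg, Matrix.fromBlocks_add]

end blocks

/-- An odd `X` with `[Y, [Y, X]] = X` is the sum of its components of hypercharge `1` and `-1`. -/
theorem odd_decomp_of_comm {ι : Type} [Fintype ι] {ε : ι → ZMod 2}
    (g : Submodule ℂ (Matrix ι ι ℂ)) {Y X : Matrix ι ι ℂ} (hY : IsEven ε Y) (hX : X ∈ g)
    (hodd : IsOdd ε X) (hYX : Y * X - X * Y ∈ g)
    (h : Y * (Y * X - X * Y) - (Y * X - X * Y) * Y = X) :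
    ∃ U ∈ g, ∃ V ∈ g, IsOdd ε U ∧ IsOdd ε V ∧ Y * U - U * Y = U ∧ Y * V - V * Y = -V ∧
      X = U + V := by
  have ho : IsOdd ε (Y * X - X * Y) := (hY.mul_odd hodd).sub (hodd.mul_even hY)
  set W := Y * X - X * Y with hW
  have half : ((1 : ℂ) / 2) • X + ((1 : ℂ) / 2) • X = X := by
    rw [← add_smul]
    norm_num
  refine ⟨((1 : ℂ) / 2) • (X + W), g.smul_mem _ (g.add_mem hX hYX),
    ((1 : ℂ) / 2) • (X - W), g.smul_mem _ (g.sub_mem hX hYX), ?_, ?_, ?_, ?_, ?_⟩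
  · intro i j e
    simp [hodd i j e, ho i j e]
  · intro i j e
    simp [hodd i j e, ho i j e]
  · rw [Matrix.mul_smul, Matrix.smul_mul, ← smul_sub, Matrix.mul_add, Matrix.add_mul,
      add_sub_add_comm, h, ← hW, add_comm]
  · rw [Matrix.mul_smul, Matrix.smul_mul, ← smul_sub, Matrix.mul_sub, Matrix.sub_mul,
      sub_sub_sub_comm, h, ← hW, ← smul_neg, neg_sub]
  · rw [← smul_add, add_add_sub_cancel, smul_add, half]

section sl

variable (m n : ℕ)

/-- The matrices with zero supertrace. -/
def slCarrier : Submodule ℂ (Matrix (Fin m ⊕ Fin n) (Fin m ⊕ Fin n) ℂ) where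
  carrier := {X | X.toBlocks₁₁.trace = X.toBlocks₂₂.trace}
  add_mem' {X Z} hX hZ := by
    change (X.toBlocks₁₁ + Z.toBlocks₁₁).trace = (X.toBlocks₂₂ + Z.toBlocks₂₂).trace
    rw [Matrix.trace_add, Matrix.trace_add, show _ = _ from hX, show _ = _ from hZ]
  zero_mem' := by
    change (0 : Matrix (Fin m) (Fin m) ℂ).trace = (0 : Matrix (Fin n) (Fin n) ℂ).trace
    simp
  smul_mem' c X hX := by
    change (c • X.toBlocks₁₁).trace = (c • X.toBlocks₂₂).trace
    rw [Matrix.trace_smul, Matrix.trace_smul, show _ = _ from hX]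

theorem fromBlocks_mem_slCarrier (A : Matrix (Fin m) (Fin m) ℂ) (B C E) :
    Matrix.fromBlocks A B C E ∈ slCarrier m n ↔ A.trace = E.trace := Iff.rfl

/-- The diagonal matrix with entries `n / (n - m)` and `m / (n - m)`. -/
noncomputable def slY : Matrix (Fin m ⊕ Fin n) (Fin m ⊕ Fin n) ℂ :=
  Matrix.fromBlocks (((n : ℂ) / (n - m)) • 1) 0 0 (((m : ℂ) / (n - m)) • 1)

/-- The subalgebra `𝔰𝔩(m) ⊕ 𝔰𝔩(n)` of block diagonal matrices. -/
def slSS : LieSubalgebra ℂ (Matrix (Fin m ⊕ Fin n) (Fin m ⊕ Fin n) ℂ) where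
  carrier := {X | (X.toBlocks₁₂ = 0 ∧ X.toBlocks₂₁ = 0) ∧
    X.toBlocks₁₁.trace = 0 ∧ X.toBlocks₂₂.trace = 0}
  add_mem' {X Z} hX hZ := by
    obtain ⟨⟨h1, h2⟩, h3, h4⟩ := hX
    obtain ⟨⟨k1, k2⟩, k3, k4⟩ := hZ
    change (X.toBlocks₁₂ + Z.toBlocks₁₂ = 0 ∧ X.toBlocks₂₁ + Z.toBlocks₂₁ = 0) ∧
      (X.toBlocks₁₁ + Z.toBlocks₁₁).trace = 0 ∧ (X.toBlocks₂₂ + Z.toBlocks₂₂).trace = 0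
    simp [h1, h2, h3, h4, k1, k2, k3, k4, Matrix.trace_add]
  zero_mem' := by
    change ((0 : Matrix (Fin m) (Fin n) ℂ) = 0 ∧ (0 : Matrix (Fin n) (Fin m) ℂ) = 0) ∧
      (0 : Matrix (Fin m) (Fin m) ℂ).trace = 0 ∧ (0 : Matrix (Fin n) (Fin n) ℂ).trace = 0
    simp
  smul_mem' c X hX := by
    obtain ⟨⟨h1, h2⟩, h3, h4⟩ := hX
    change (c • X.toBlocks₁₂ = 0 ∧ c • X.toBlocks₂₁ = 0) ∧
      (c • X.toBlocks₁₁).trace = 0 ∧ (c • X.toBlocks₂₂).trace = 0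
    simp [h1, h2, h3, h4, Matrix.trace_smul]
  lie_mem' {X Z} hX hZ := by
    change X * Z - Z * X ∈ _
    rw [toBlocks_lie hX.1 hZ.1]
    refine ⟨⟨rfl, rfl⟩, ?_, ?_⟩ <;>
      simp only [Matrix.toBlocks_fromBlocks₁₁, Matrix.toBlocks_fromBlocks₂₂] <;>
      rw [Matrix.trace_sub, Matrix.trace_mul_comm, sub_self]

variable {m n}

theorem slCarrier_comm {X Z : Matrix (Fin m ⊕ Fin n) (Fin m ⊕ Fin n) ℂ}
    (he : IsEven (parityOf (Fin m) (Fin n)) X) : X * Z - Z * X ∈ slCarrier m n := by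
  rw [he.blocks, ← Matrix.fromBlocks_toBlocks Z, Matrix.fromBlocks_multiply,
    Matrix.fromBlocks_multiply, sub_eq_add_neg, Matrix.fromBlocks_neg, Matrix.fromBlocks_add,
    fromBlocks_mem_slCarrier]
  simp only [Matrix.zero_mul, Matrix.mul_zero, add_zero, zero_add, ← sub_eq_add_neg,
    Matrix.trace_sub]
  rw [Matrix.trace_mul_comm, sub_self, Matrix.trace_mul_comm, sub_self]

theorem slCarrier_anticomm {X Z : Matrix (Fin m ⊕ Fin n) (Fin m ⊕ Fin n) ℂ}
    (hX : IsOdd (parityOf (Fin m) (Fin n)) X) (hZ : IsOdd (parityOf (Fin m) (Fin n)) Z) :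
    X * Z + Z * X ∈ slCarrier m n := by
  rw [hX.blocks, hZ.blocks, Matrix.fromBlocks_multiply,
    Matrix.fromBlocks_multiply, Matrix.fromBlocks_add, fromBlocks_mem_slCarrier]
  simp only [Matrix.mul_zero, add_zero, zero_add, Matrix.trace_add]
  rw [Matrix.trace_mul_comm, Matrix.trace_mul_comm Z.toBlocks₁₂, add_comm]

theorem slY_mem : slY m n ∈ slCarrier m n := by
  rw [slY, fromBlocks_mem_slCarrier]
  simp only [Matrix.trace_smul, Matrix.trace_one, Fintype.card_fin, smul_eq_mul]
  ring

theorem slY_comm {X : Matrix (Fin m ⊕ Fin n) (Fin m ⊕ Fin n) ℂ}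
    (he : IsEven (parityOf (Fin m) (Fin n)) X) : slY m n * X = X * slY m n := by
  rw [he.blocks, slY]
  simp [Matrix.fromBlocks_multiply]

theorem slY_comm_comm (h : m ≠ n) {X : Matrix (Fin m ⊕ Fin n) (Fin m ⊕ Fin n) ℂ}
    (ho : IsOdd (parityOf (Fin m) (Fin n)) X) :
    slY m n * (slY m n * X - X * slY m n) - (slY m n * X - X * slY m n) * slY m n = X := by
  have hd : (n : ℂ) - m ≠ 0 := sub_ne_zero.2 (by exact_mod_cast h.symm)
  have e : (n : ℂ) / (n - m) = m / (n - m) + 1 := by field_simp; ring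
  rw [ho.blocks, slY, e]
  generalize (m : ℂ) / (n - m) = t
  simp only [Matrix.fromBlocks_multiply, sub_eq_add_neg, Matrix.fromBlocks_neg,
    Matrix.fromBlocks_add, Matrix.zero_mul, Matrix.mul_zero, add_zero, zero_add,
    Matrix.smul_mul, Matrix.mul_smul, Matrix.one_mul, Matrix.mul_one]
  congr 1 <;> module

/-- The Lie superalgebra `𝔰𝔩(m|n)`, for `m ≠ n`. -/
noncomputable def sl (m n : ℕ) (hm : 1 ≤ m) (hn : 1 ≤ n) (h : m ≠ n) : HyperSuperalgebra where
  idx := Fin m ⊕ Fin n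
  parity := parityOf (Fin m) (Fin n)
  carrier := slCarrier m n
  evenPart_mem X hX := by
    rw [← Matrix.fromBlocks_toBlocks X, evenPart_fromBlocks]
    exact hX
  comm_mem X _ he Z _ := slCarrier_comm he
  anticomm_mem X _ hX Z _ hZ := slCarrier_anticomm hX hZ
  Y := ⟨slY m n, slY_mem⟩
  ss := slSS m n
  ss_mem X hX := hX.2.1.trans hX.2.2.symm
  ss_even X hX := by
    rw [← Matrix.fromBlocks_toBlocks X, hX.1.1, hX.1.2]
    exact isEven_fromBlocks _ _
  Y_even := isEven_fromBlocks _ _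
  Y_comm _ _ he := slY_comm he
  even_decomp X hX he := by
    have hd : (n : ℂ) - m ≠ 0 := sub_ne_zero.2 (by exact_mod_cast h.symm)
    have hm' : (m : ℂ) ≠ 0 := by exact_mod_cast (by omega : m ≠ 0)
    have hn' : (n : ℂ) ≠ 0 := by exact_mod_cast (by omega : n ≠ 0)
    have hX' : X.toBlocks₁₁.trace = X.toBlocks₂₂.trace := hX
    refine ⟨X - (X.toBlocks₁₁.trace * (n - m) / (m * n)) • slY m n, ⟨⟨?_, ?_⟩, ?_, ?_⟩,
      X.toBlocks₁₁.trace * (n - m) / (m * n), by simp⟩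
    · rw [he.blocks, slY, sub_eq_add_neg, Matrix.fromBlocks_smul, Matrix.fromBlocks_neg,
        Matrix.fromBlocks_add]
      simp
    · rw [he.blocks, slY, sub_eq_add_neg, Matrix.fromBlocks_smul, Matrix.fromBlocks_neg,
        Matrix.fromBlocks_add]
      simp
    · change (X.toBlocks₁₁ - (X.toBlocks₁₁.trace * (n - m) / (m * n)) •
        (((n : ℂ) / (n - m)) • (1 : Matrix (Fin m) (Fin m) ℂ))).trace = 0
      simp only [Matrix.trace_sub, Matrix.trace_smul, Matrix.trace_one, Fintype.card_fin,
        smul_eq_mul]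
      field_simp
      ring
    · change (X.toBlocks₂₂ - (X.toBlocks₁₁.trace * (n - m) / (m * n)) •
        (((m : ℂ) / (n - m)) • (1 : Matrix (Fin n) (Fin n) ℂ))).trace = 0
      simp only [Matrix.trace_sub, Matrix.trace_smul, Matrix.trace_one, Fintype.card_fin,
        smul_eq_mul]
      rw [hX']
      field_simp
      ring
  Y_notMem hY := by
    have hd : (n : ℂ) - m ≠ 0 := sub_ne_zero.2 (by exact_mod_cast h.symm)
    have hm' : (m : ℂ) ≠ 0 := by exact_mod_cast (by omega : m ≠ 0)
    have hn' : (n : ℂ) ≠ 0 := by exact_mod_cast (by omega : n ≠ 0)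
    have := hY.2.1
    simp [slY, Matrix.trace_smul, hd, hm', hn'] at this
  odd_decomp _ hX ho := odd_decomp_of_comm _ (isEven_fromBlocks _ _) hX ho
    (slCarrier_comm (isEven_fromBlocks _ _)) (slY_comm_comm h ho)

end sl

section osp

variable (n : ℕ)

/-- The matrix of the supersymmetric bilinear form on `ℂ^(2|2n)`, which is symmetric and
nondegenerate on `ℂ^2`, skew-symmetric and nondegenerate on `ℂ^(2n)`. -/
def ospForm : Matrix (Fin 2 ⊕ (Fin n ⊕ Fin n)) (Fin 2 ⊕ (Fin n ⊕ Fin n)) ℂ :=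
  Matrix.fromBlocks !![0, 1; 1, 0] 0 0 (Matrix.fromBlocks 0 1 (-1) 0)

/-- The matrix `(-1)^(parity)`. -/
def ospSign : Matrix (Fin 2 ⊕ (Fin n ⊕ Fin n)) (Fin 2 ⊕ (Fin n ⊕ Fin n)) ℂ :=
  Matrix.fromBlocks 1 0 0 (-1)

/-- The matrices `X` that preserve the form `B`: `B (X a) b + (-1)^(|X||a|) B a (X b) = 0` for the
homogeneous parts of `X`. -/
def ospCarrier : Submodule ℂ (Matrix (Fin 2 ⊕ (Fin n ⊕ Fin n)) (Fin 2 ⊕ (Fin n ⊕ Fin n)) ℂ) where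
  carrier := {X |
    (evenPart (parityOf (Fin 2) (Fin n ⊕ Fin n)) X).transpose * ospForm n
      + ospForm n * evenPart (parityOf (Fin 2) (Fin n ⊕ Fin n)) X = 0 ∧
    (oddPart (parityOf (Fin 2) (Fin n ⊕ Fin n)) X).transpose * ospForm n
      + ospSign n * ospForm n * oddPart (parityOf (Fin 2) (Fin n ⊕ Fin n)) X = 0}
  add_mem' {X Z} hX hZ := by
    constructor
    · rw [map_add, Matrix.transpose_add, Matrix.add_mul, Matrix.mul_add, add_add_add_comm,
        hX.1, hZ.1, add_zero]
    · rw [map_add, Matrix.transpose_add, Matrix.add_mul, Matrix.mul_add, add_add_add_comm,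
        hX.2, hZ.2, add_zero]
  zero_mem' := by constructor <;> simp
  smul_mem' c X hX := by
    constructor
    · rw [map_smul, Matrix.transpose_smul, Matrix.smul_mul, Matrix.mul_smul, ← smul_add,
        hX.1, smul_zero]
    · rw [map_smul, Matrix.transpose_smul, Matrix.smul_mul, Matrix.mul_smul, ← smul_add,
        hX.2, smul_zero]

/-- The diagonal matrix with entries `1`, `-1` on `ℂ^2` and zero on `ℂ^(2n)`. -/
def ospY : Matrix (Fin 2 ⊕ (Fin n ⊕ Fin n)) (Fin 2 ⊕ (Fin n ⊕ Fin n)) ℂ :=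
  Matrix.fromBlocks !![1, 0; 0, -1] 0 0 0

/-- The subalgebra `𝔰𝔭(2n)`, acting on the odd part `ℂ^(2n)` of `ℂ^(2|2n)`. -/
def ospSS : LieSubalgebra ℂ (Matrix (Fin 2 ⊕ (Fin n ⊕ Fin n)) (Fin 2 ⊕ (Fin n ⊕ Fin n)) ℂ) where
  carrier := {X | (X.toBlocks₁₂ = 0 ∧ X.toBlocks₂₁ = 0) ∧ X.toBlocks₁₁ = 0 ∧
    X.toBlocks₂₂.transpose * Matrix.fromBlocks 0 1 (-1) 0
      + Matrix.fromBlocks 0 1 (-1) 0 * X.toBlocks₂₂ = 0}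
  add_mem' {X Z} hX hZ := by
    obtain ⟨⟨h1, h2⟩, h3, h4⟩ := hX
    obtain ⟨⟨k1, k2⟩, k3, k4⟩ := hZ
    change (X.toBlocks₁₂ + Z.toBlocks₁₂ = 0 ∧ X.toBlocks₂₁ + Z.toBlocks₂₁ = 0) ∧
      X.toBlocks₁₁ + Z.toBlocks₁₁ = 0 ∧ (X.toBlocks₂₂ + Z.toBlocks₂₂).transpose * _ +
        _ * (X.toBlocks₂₂ + Z.toBlocks₂₂) = 0
    refine ⟨⟨by simp [h1, k1], by simp [h2, k2]⟩, by simp [h3, k3], ?_⟩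
    rw [Matrix.transpose_add, Matrix.add_mul, Matrix.mul_add, add_add_add_comm, h4, k4, add_zero]
  zero_mem' := by
    refine ⟨⟨rfl, rfl⟩, rfl, ?_⟩
    change (0 : Matrix (Fin n ⊕ Fin n) (Fin n ⊕ Fin n) ℂ).transpose * _ + _ * 0 = 0
    simp
  smul_mem' c X hX := by
    obtain ⟨⟨h1, h2⟩, h3, h4⟩ := hX
    change (c • X.toBlocks₁₂ = 0 ∧ c • X.toBlocks₂₁ = 0) ∧ c • X.toBlocks₁₁ = 0 ∧
      (c • X.toBlocks₂₂).transpose * _ + _ * (c • X.toBlocks₂₂) = 0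
    refine ⟨⟨by simp [h1], by simp [h2]⟩, by simp [h3], ?_⟩
    rw [Matrix.transpose_smul, Matrix.smul_mul, Matrix.mul_smul, ← smul_add, h4, smul_zero]
  lie_mem' {X Z} hX hZ := by
    change X * Z - Z * X ∈ _
    rw [toBlocks_lie hX.1 hZ.1]
    refine ⟨⟨rfl, rfl⟩, ?_, ?_⟩
    · simp [hX.2.1, hZ.2.1]
    · have h := eq_neg_of_add_eq_zero_left hX.2.2
      have k := eq_neg_of_add_eq_zero_left hZ.2.2
      simp only [Matrix.toBlocks_fromBlocks₂₂, Matrix.transpose_sub, Matrix.transpose_mul]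
      rw [Matrix.sub_mul, Matrix.mul_assoc, Matrix.mul_assoc, h, k, Matrix.mul_neg, Matrix.mul_neg,
        ← Matrix.mul_assoc, ← Matrix.mul_assoc, h, k]
      noncomm_ring

variable {n}

theorem ospSign_comm {X : Matrix (Fin 2 ⊕ (Fin n ⊕ Fin n)) (Fin 2 ⊕ (Fin n ⊕ Fin n)) ℂ}
    (h : IsEven (parityOf (Fin 2) (Fin n ⊕ Fin n)) X) : X * ospSign n = ospSign n * X := by
  rw [h.blocks]
  simp [ospSign, Matrix.fromBlocks_multiply]

theorem ospSign_anticomm {X : Matrix (Fin 2 ⊕ (Fin n ⊕ Fin n)) (Fin 2 ⊕ (Fin n ⊕ Fin n)) ℂ}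
    (h : IsOdd (parityOf (Fin 2) (Fin n ⊕ Fin n)) X) : X * ospSign n = -(ospSign n * X) := by
  rw [h.blocks]
  simp [ospSign, Matrix.fromBlocks_multiply, Matrix.fromBlocks_neg]

theorem ospSign_sq : ospSign n * ospSign n = 1 := by
  simp [ospSign, Matrix.fromBlocks_multiply]

theorem IsOdd.transpose {ι : Type} {ε : ι → ZMod 2} {X : Matrix ι ι ℂ} (h : IsOdd ε X) :
    IsOdd ε X.transpose := fun i j e => h j i e.symm

theorem IsEven.transpose {ι : Type} {ε : ι → ZMod 2} {X : Matrix ι ι ℂ} (h : IsEven ε X) :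
    IsEven ε X.transpose := fun i j e => h j i e.symm

theorem ospCarrier_comm {X Z : Matrix (Fin 2 ⊕ (Fin n ⊕ Fin n)) (Fin 2 ⊕ (Fin n ⊕ Fin n)) ℂ}
    (hX : X ∈ ospCarrier n) (he : IsEven (parityOf (Fin 2) (Fin n ⊕ Fin n)) X)
    (hZ : Z ∈ ospCarrier n) : X * Z - Z * X ∈ ospCarrier n := by
  have h := hX.1
  rw [evenPart_of_isEven he] at h
  have h := eq_neg_of_add_eq_zero_left h
  have k := eq_neg_of_add_eq_zero_left hZ.1
  have l := eq_neg_of_add_eq_zero_left hZ.2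
  constructor
  · rw [evenPart_comm he]
    simp only [Matrix.transpose_sub, Matrix.transpose_mul]
    rw [Matrix.sub_mul, Matrix.mul_assoc, Matrix.mul_assoc, h, k, Matrix.mul_neg, Matrix.mul_neg,
        ← Matrix.mul_assoc, ← Matrix.mul_assoc, h, k]
    noncomm_ring
  · rw [oddPart_comm he]
    simp only [Matrix.transpose_sub, Matrix.transpose_mul]
    rw [Matrix.sub_mul, Matrix.mul_assoc, Matrix.mul_assoc, h, l, Matrix.mul_neg, Matrix.mul_neg,
        ← Matrix.mul_assoc, ← Matrix.mul_assoc, ← Matrix.mul_assoc, l, ospSign_comm he.transpose,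
        Matrix.mul_assoc (ospSign n) X.transpose, h]
    noncomm_ring

theorem ospCarrier_anticomm {X Z : Matrix (Fin 2 ⊕ (Fin n ⊕ Fin n)) (Fin 2 ⊕ (Fin n ⊕ Fin n)) ℂ}
    (hX : X ∈ ospCarrier n) (hoX : IsOdd (parityOf (Fin 2) (Fin n ⊕ Fin n)) X)
    (hZ : Z ∈ ospCarrier n) (hoZ : IsOdd (parityOf (Fin 2) (Fin n ⊕ Fin n)) Z) :
    X * Z + Z * X ∈ ospCarrier n := by
  have h := hX.2
  rw [oddPart_of_isOdd hoX] at h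
  have h := eq_neg_of_add_eq_zero_left h
  have k := hZ.2
  rw [oddPart_of_isOdd hoZ] at k
  have k := eq_neg_of_add_eq_zero_left k
  have e := (hoX.mul hoZ).add (hoZ.mul hoX)
  have aux : ∀ M T : Matrix (Fin 2 ⊕ (Fin n ⊕ Fin n)) (Fin 2 ⊕ (Fin n ⊕ Fin n)) ℂ,
      IsOdd (parityOf (Fin 2) (Fin n ⊕ Fin n)) M →
      M.transpose * ospForm n = -(ospSign n * ospForm n * M) →
      M.transpose * (ospSign n * ospForm n * T) = ospForm n * M * T := by
    intro M T hM hMB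
    rw [← Matrix.mul_assoc, ← Matrix.mul_assoc, ospSign_anticomm hM.transpose, Matrix.neg_mul,
      Matrix.mul_assoc (ospSign n), hMB, Matrix.mul_neg, neg_neg, ← Matrix.mul_assoc,
      ← Matrix.mul_assoc, ospSign_sq, Matrix.one_mul]
  constructor
  · rw [evenPart_of_isEven e]
    simp only [Matrix.transpose_add, Matrix.transpose_mul]
    rw [Matrix.add_mul, Matrix.mul_assoc, Matrix.mul_assoc, h, k, Matrix.mul_neg, Matrix.mul_neg,
      aux _ _ hoZ k, aux _ _ hoX h]
    noncomm_ring
  · rw [oddPart_of_isEven e]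
    simp

theorem ospY_even : IsEven (parityOf (Fin 2) (Fin n ⊕ Fin n)) (ospY n) := isEven_fromBlocks _ _

theorem ospY_mem : ospY n ∈ ospCarrier n := by
  constructor
  · rw [evenPart_of_isEven ospY_even]
    have e : (!![1, 0; 0, -1] : Matrix (Fin 2) (Fin 2) ℂ).transpose * !![0, 1; 1, 0]
        + !![0, 1; 1, 0] * !![1, 0; 0, -1] = 0 := by
      ext i j
      fin_cases i <;> fin_cases j <;> simp [Matrix.mul_apply, Fin.sum_univ_two]
    rw [ospY, ospForm, Matrix.fromBlocks_transpose, Matrix.fromBlocks_multiply,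
      Matrix.fromBlocks_multiply, Matrix.fromBlocks_add]
    simp only [Matrix.transpose_zero, Matrix.zero_mul, Matrix.mul_zero, add_zero, e,
      Matrix.fromBlocks_zero]
  · rw [oddPart_of_isEven ospY_even]
    simp

theorem ospCarrier_blocks {X : Matrix (Fin 2 ⊕ (Fin n ⊕ Fin n)) (Fin 2 ⊕ (Fin n ⊕ Fin n)) ℂ}
    (hX : X ∈ ospCarrier n) :
    X.toBlocks₁₁ = X.toBlocks₁₁ 0 0 • !![1, 0; 0, -1] ∧
    X.toBlocks₂₂.transpose * Matrix.fromBlocks 0 1 (-1) 0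
      + Matrix.fromBlocks 0 1 (-1) 0 * X.toBlocks₂₂ = 0 := by
  have h := hX.1
  rw [← Matrix.fromBlocks_toBlocks X, evenPart_fromBlocks, ospForm, Matrix.fromBlocks_transpose,
    Matrix.fromBlocks_multiply, Matrix.fromBlocks_multiply, Matrix.fromBlocks_add] at h
  simp only [Matrix.transpose_zero, Matrix.zero_mul, Matrix.mul_zero, add_zero, zero_add] at h
  rw [← Matrix.fromBlocks_zero, Matrix.fromBlocks_inj] at h
  refine ⟨?_, h.2.2.2⟩
  have h1 := h.1
  generalize X.toBlocks₁₁ = A at h1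
  have h00 := congrFun (congrFun h1 0) 0
  have h01 := congrFun (congrFun h1 0) 1
  have h11 := congrFun (congrFun h1 1) 1
  simp only [Matrix.add_apply, Matrix.mul_apply, Fin.sum_univ_two, Matrix.transpose_apply,
    Matrix.of_apply, Matrix.cons_val_zero, Matrix.cons_val_one, Matrix.zero_apply] at h00 h01 h11
  ext i j
  fin_cases i <;> fin_cases j <;> simp
  · linear_combination h11 / 2
  · linear_combination h00 / 2
  · linear_combination h01

theorem ospCarrier_even_decomp
    {X : Matrix (Fin 2 ⊕ (Fin n ⊕ Fin n)) (Fin 2 ⊕ (Fin n ⊕ Fin n)) ℂ}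
    (hX : X ∈ ospCarrier n) (he : IsEven (parityOf (Fin 2) (Fin n ⊕ Fin n)) X) :
    ∃ S ∈ ospSS n, ∃ t : ℂ, X = S + t • ospY n := by
  obtain ⟨h1, h2⟩ := ospCarrier_blocks hX
  refine ⟨Matrix.fromBlocks 0 0 0 X.toBlocks₂₂, ⟨⟨rfl, rfl⟩, rfl, h2⟩, X.toBlocks₁₁ 0 0, ?_⟩
  rw [ospY, Matrix.fromBlocks_smul, ← h1, Matrix.fromBlocks_add]
  simpa using he.blocks

/-- The Lie superalgebra `𝔬𝔰𝔭(2|2n)`. -/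
noncomputable def osp (n : ℕ) : HyperSuperalgebra where
  idx := Fin 2 ⊕ (Fin n ⊕ Fin n)
  parity := parityOf (Fin 2) (Fin n ⊕ Fin n)
  carrier := ospCarrier n
  evenPart_mem X hX := by
    refine ⟨?_, ?_⟩
    · rw [evenPart_of_isEven (isEven_evenPart X)]
      exact hX.1
    · rw [oddPart_of_isEven (isEven_evenPart X)]
      simp
  comm_mem X hX he Z hZ := ospCarrier_comm hX he hZ
  anticomm_mem X hX hoX Z hZ hoZ := ospCarrier_anticomm hX hoX hZ hoZ
  Y := ⟨ospY n, ospY_mem⟩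
  ss := ospSS n
  ss_mem X hX := by
    have e : X = Matrix.fromBlocks 0 0 0 X.toBlocks₂₂ := by
      conv_lhs => rw [← Matrix.fromBlocks_toBlocks X, hX.1.1, hX.1.2, hX.2.1]
    have he : IsEven (parityOf (Fin 2) (Fin n ⊕ Fin n)) X := by
      rw [e]
      exact isEven_fromBlocks _ _
    refine ⟨?_, ?_⟩
    · rw [evenPart_of_isEven he, e, ospForm, Matrix.fromBlocks_transpose,
        Matrix.fromBlocks_multiply, Matrix.fromBlocks_multiply, Matrix.fromBlocks_add]
      simp only [Matrix.transpose_zero, Matrix.zero_mul, Matrix.mul_zero, add_zero, zero_add,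
        hX.2.2, Matrix.fromBlocks_zero]
    · rw [oddPart_of_isEven he]
      simp
  ss_even X hX := by
    rw [← Matrix.fromBlocks_toBlocks X, hX.1.1, hX.1.2]
    exact isEven_fromBlocks _ _
  Y_even := ospY_even
  Y_comm X hX he := by
    obtain ⟨S, hS, t, rfl⟩ := ospCarrier_even_decomp hX he
    have e : S = Matrix.fromBlocks 0 0 0 S.toBlocks₂₂ := by
      conv_lhs => rw [← Matrix.fromBlocks_toBlocks S, hS.1.1, hS.1.2, hS.2.1]
    have h1 : ospY n * S = 0 := by
      rw [e, ospY]
      simp [Matrix.fromBlocks_multiply]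
    have h2 : S * ospY n = 0 := by
      rw [e, ospY]
      simp [Matrix.fromBlocks_multiply]
    rw [Matrix.mul_add, Matrix.add_mul, h1, h2, Matrix.mul_smul, Matrix.smul_mul]
  even_decomp X hX he := ospCarrier_even_decomp hX he
  Y_notMem hY := by
    have := congrFun (congrFun hY.2.1 0) 0
    simp [ospY] at this
  odd_decomp X hX ho := by
    refine odd_decomp_of_comm _ ospY_even hX ho (ospCarrier_comm ospY_mem ospY_even hX) ?_
    have e : (!![1, 0; 0, -1] : Matrix (Fin 2) (Fin 2) ℂ) * !![1, 0; 0, -1] = 1 := by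
      ext i j
      fin_cases i <;> fin_cases j <;> simp
    rw [ho.blocks]
    simp only [ospY, Matrix.fromBlocks_multiply, sub_eq_add_neg, Matrix.fromBlocks_neg,
      Matrix.fromBlocks_add]
    simp only [Matrix.zero_mul, Matrix.mul_zero, add_zero, zero_add, neg_zero, Matrix.neg_mul,
      neg_neg, ← Matrix.mul_assoc, e, Matrix.one_mul]
    rw [Matrix.mul_assoc, e, Matrix.mul_one]

end osp

/-- The two series of Lie superalgebras: `𝔰𝔩(m|n)` with `m, n ≥ 1`, `m ≠ n`, and `𝔬𝔰𝔭(2|2n)` with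
`n ≥ 1`. -/
inductive IsTypeI : HyperSuperalgebra → Prop
  | sl (m n : ℕ) (hm : 1 ≤ m) (hn : 1 ≤ n) (h : m ≠ n) : IsTypeI (sl m n hm hn h)
  | osp (n : ℕ) (hn : 1 ≤ n) : IsTypeI (osp n)

end Matryoshka

/-! The mechanism is that the whole family `K(L, y)` lives on one space, where the action is affine
in `y`. As a module over the exterior algebra of the lowering elements, a Kac module is free on `L`,
and this structure does not see `y`. Take a free module `M` of this kind (`IsFree`), with the
lowering elements acting by fixed operators. The other operators are forced by recursion from `L`:
`a (v m) = [a, v] m + v (a m)` for `a` even, and `u (v m) = {u, v} m - v (u m)` for `u` raising.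
Such recursions are solvable by `IsFree.exists_rec`. The Jacobi identity shows that the result
respects every superbracket (`IsModelAct.isAction`), and `IsModelAct.exists_equiv` identifies it
with the Kac module.

The parameter enters only through the start `Y l = y • l`, and the recursions are linear in the
unknown operators because the lowering operators are fixed. Hence `A_y = A₀ + y • (A₁ - A₀)`
(`IsModelAct.affine`). Elements of `lowerEnv` act on `M` independently of `y` (`lift_lowerEnv`), so
the vectors `c_j Λ` correspond to one basis of `M` for all `y`, and the Kac matrices are affine in
`y` with slope `ρ'`.

Since the relations hold for every `y`, powers of `y` can be compared: the quadratic coefficient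
says that the brackets of the slopes vanish, the linear one is a Leibniz rule. These are exactly the
conditions for replacing the number `y` by `y + S`, with `S` the matrix of the `λ_i` above the
diagonal. The block matrix `1 ⊗ ρ_y(x) + S ⊗ ρ'(x)` is that substitution.

For indecomposability, take an invariant subspace with a vector whose last block has a nonzero
coordinate at an index with `p_j = 0`. Factors `Y - (y - q)` with `q > 0` push this vector into
`L^N` without killing that coordinate. On `L^N` the operator `Y - y` is the weighted shift, so
irreducibility of `L` and nonzero `λ_i` give all of `L^N`, and the lowering elements then give
everything (`invariant_eq_top`). In a direct sum decomposition one summand must contain such a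
vector, hence is the whole space. -/

namespace Matryoshka

/-! ### The free module over an exterior algebra -/

section free

variable {V L X : Type*} [AddCommGroup V] [Module ℂ V] [AddCommGroup L] [Module ℂ L]
  [AddCommGroup X] [Module ℂ X]

variable (V L) in
/-- Left multiplication by the generators on the free module `Λ(V) ⊗ L`. -/
noncomputable def freeMul : V →ₗ[ℂ] Module.End ℂ (ExteriorAlgebra ℂ V ⊗[ℂ] L) :=
  LinearMap.rTensorHom L ∘ₗ LinearMap.mul ℂ (ExteriorAlgebra ℂ V) ∘ₗ ExteriorAlgebra.ι ℂ

theorem freeMul_tmul (v : V) (ω : ExteriorAlgebra ℂ V) (l : L) :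
    freeMul V L v (ω ⊗ₜ l) = (ExteriorAlgebra.ι ℂ v * ω) ⊗ₜ l := rfl

theorem freeMul_anticomm (v w : V) (m : ExteriorAlgebra ℂ V ⊗[ℂ] L) :
    freeMul V L v (freeMul V L w m) + freeMul V L w (freeMul V L v m) = 0 := by
  induction m with
  | zero => simp
  | add m n hm hn =>
    simp only [map_add]
    rw [add_add_add_comm, hm, hn, add_zero]
  | tmul ω l =>
    rw [freeMul_tmul, freeMul_tmul, freeMul_tmul, freeMul_tmul, ← TensorProduct.add_tmul,
      ← mul_assoc, ← mul_assoc, ← add_mul, ExteriorAlgebra.ι_add_mul_swap, zero_mul,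
      TensorProduct.zero_tmul]

/-- A subspace of `Λ(V) ⊗ L` that contains `1 ⊗ L` and is stable under `V` is everything. -/
theorem free_eq_top (S : Submodule ℂ (ExteriorAlgebra ℂ V ⊗[ℂ] L))
    (h1 : ∀ l : L, (1 : ExteriorAlgebra ℂ V) ⊗ₜ[ℂ] l ∈ S)
    (hV : ∀ v, ∀ m ∈ S, freeMul V L v m ∈ S) : S = ⊤ := by
  have key : ∀ ω : ExteriorAlgebra ℂ V, ∀ m ∈ S,
      (LinearMap.mul ℂ (ExteriorAlgebra ℂ V) ω).rTensor L m ∈ S := by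
    intro ω
    induction ω using ExteriorAlgebra.induction with
    | algebraMap r =>
      intro m hm
      have : (LinearMap.mul ℂ (ExteriorAlgebra ℂ V) (algebraMap ℂ _ r)).rTensor L m = r • m := by
        have e : LinearMap.mul ℂ (ExteriorAlgebra ℂ V) (algebraMap ℂ _ r)
            = r • LinearMap.id := by
          ext ω
          simp [Algebra.smul_def]
        rw [e, LinearMap.rTensor_smul, LinearMap.rTensor_id]
        rfl
      rw [this]
      exact S.smul_mem r hm
    | ι v => exact hV v
    | mul a b ha hb =>
      intro m hm
      have e : LinearMap.mul ℂ (ExteriorAlgebra ℂ V) (a * b)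
          = LinearMap.mul ℂ _ a ∘ₗ LinearMap.mul ℂ _ b := by
        ext ω
        simp [mul_assoc]
      rw [e, LinearMap.rTensor_comp]
      exact ha _ (hb _ hm)
    | add a b ha hb =>
      intro m hm
      rw [map_add, LinearMap.rTensor_add]
      exact S.add_mem (ha _ hm) (hb _ hm)
  rw [eq_top_iff]
  rintro m -
  induction m with
  | zero => exact S.zero_mem
  | add m n hm hn => exact S.add_mem hm hn
  | tmul ω l => simpa using key ω _ (h1 l)

/-- Operators of square zero extend from `V` to an algebra map on the exterior algebra; then `ω ⊗ l`
goes to `ω` applied to `φ l`. -/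
theorem exists_free_lift (f : V →ₗ[ℂ] Module.End ℂ X) (hf : ∀ v m, f v (f v m) = 0)
    (φ : L →ₗ[ℂ] X) : ∃ T : ExteriorAlgebra ℂ V ⊗[ℂ] L →ₗ[ℂ] X,
      (∀ l : L, T ((1 : ExteriorAlgebra ℂ V) ⊗ₜ[ℂ] l) = φ l) ∧
      ∀ v m, T (freeMul V L v m) = f v (T m) := by
  refine ⟨TensorProduct.lift (LinearMap.lcomp ℂ X φ ∘ₗ
    (ExteriorAlgebra.lift ℂ ⟨f, fun v => LinearMap.ext (hf v)⟩).toLinearMap), fun l => ?_,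
    fun v m => ?_⟩
  · simp
  · induction m with
    | zero => simp
    | add m n hm hn => simp only [map_add, hm, hn]
    | tmul ω l => simp [freeMul_tmul]

/-- Products of more than `dim V` vectors vanish, being alternating in linearly dependent arguments,
so finitely many exterior powers suffice. -/
instance finite_exteriorAlgebra [FiniteDimensional ℂ V] :
    FiniteDimensional ℂ (ExteriorAlgebra ℂ V) := by
  have h : (⨆ n : Fin (Module.finrank ℂ V + 1), ⋀[ℂ]^(n : ℕ) V) = ⊤ := by
    rw [eq_top_iff, ← ExteriorAlgebra.ιMulti_span, Submodule.span_le]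
    rintro _ ⟨⟨n, v⟩, rfl⟩
    by_cases hn : n < Module.finrank ℂ V + 1
    · exact Submodule.mem_iSup_of_mem (⟨n, hn⟩ : Fin _)
        (ExteriorAlgebra.ιMulti_range ℂ n ⟨v, rfl⟩)
    · have : ExteriorAlgebra.ιMulti ℂ n v = 0 := by
        refine AlternatingMap.map_linearDependent _ v fun hv => ?_
        have := hv.fintype_card_le_finrank
        rw [Fintype.card_fin] at this
        omega
      change ExteriorAlgebra.ιMulti ℂ n v ∈ _
      rw [this]
      exact Submodule.zero_mem _
  have : Module.Finite ℂ (⊤ : Submodule ℂ (ExteriorAlgebra ℂ V)) := by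
    rw [← h]
    infer_instance
  exact Module.finite_def.2 (Module.Finite.iff_fg.1 this)

end free

-- Free modules over an exterior algebra, by their universal property

universe u

/-- `M` is the free module over the exterior algebra of `V` generated by `L`, by `top : L → M`. -/
structure IsFree {V : Type*} {L M : Type u} [AddCommMonoid V] [Module ℂ V] [AddCommGroup L]
    [Module ℂ L] [AddCommGroup M] [Module ℂ M] (low : V →ₗ[ℂ] Module.End ℂ M)
    (top : L →ₗ[ℂ] M) : Prop where
  anticomm : ∀ v w m, low v (low w m) + low w (low v m) = 0
  eq_top : ∀ S : Submodule ℂ M, (∀ l, top l ∈ S) → (∀ v, ∀ m ∈ S, low v m ∈ S) → S = ⊤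
  exists_lift : ∀ {X : Type u} [AddCommGroup X] [Module ℂ X] (f : V →ₗ[ℂ] Module.End ℂ X),
    (∀ v m, f v (f v m) = 0) → ∀ φ : L →ₗ[ℂ] X, ∃ T : M →ₗ[ℂ] X,
      (∀ l, T (top l) = φ l) ∧ ∀ v m, T (low v m) = f v (T m)

/-- The free module over an exterior algebra, generated by a finite-dimensional space. -/
theorem exists_isFree (V : Type) (L : Type u) [AddCommGroup V] [Module ℂ V]
    [FiniteDimensional ℂ V] [AddCommGroup L] [Module ℂ L] [FiniteDimensional ℂ L] :
    ∃ (M : Type u) (_ : AddCommGroup M) (_ : Module ℂ M) (_ : FiniteDimensional ℂ M)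
      (low : V →ₗ[ℂ] Module.End ℂ M) (top : L →ₗ[ℂ] M), IsFree low top :=
  ⟨ExteriorAlgebra ℂ V ⊗[ℂ] L, inferInstance, inferInstance, inferInstance, freeMul V L,
    TensorProduct.mk ℂ (ExteriorAlgebra ℂ V) L 1, freeMul_anticomm, free_eq_top, exists_free_lift⟩

namespace IsFree

variable {V : Type*} {L M : Type u} [AddCommMonoid V] [Module ℂ V] [AddCommGroup L]
  [Module ℂ L] [AddCommGroup M] [Module ℂ M] {low : V →ₗ[ℂ] Module.End ℂ M} {top : L →ₗ[ℂ] M}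

/-- The induction principle behind the operator identities on `M`: check on `L`, then pass from `m`
to `v m`. It holds because the equalizer of `f` and `g` contains `L` and is stable under `V`. -/
theorem hom_ext (h : IsFree low top) {X : Type*} [AddCommGroup X] [Module ℂ X] {f g : M →ₗ[ℂ] X}
    (h1 : ∀ l, f (top l) = g (top l))
    (hV : ∀ v m, f m = g m → f (low v m) = g (low v m)) : f = g := by
  have := h.eq_top (LinearMap.eqLocus f g) h1 hV
  exact LinearMap.ext fun m => (show m ∈ LinearMap.eqLocus f g by rw [this]; trivial)

theorem sq_eq_zero (h : IsFree low top) (v : V) (m : M) : low v (low v m) = 0 := by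
  have := h.anticomm v v m
  rwa [← two_smul ℂ, smul_eq_zero_iff_right two_ne_zero] at this

/-- Letting `V` act on `L` by zero, the lift of the identity is a left inverse. -/
theorem top_injective (h : IsFree low top) : Function.Injective top := by
  obtain ⟨T, hT, -⟩ := h.exists_lift (X := L) 0 (fun _ _ => rfl) LinearMap.id
  exact Function.LeftInverse.injective hT

/-- Recursive definition of an operator `T` by `T v = β(v) + ε v T`. -/
theorem exists_rec (h : IsFree low top) (ε : ℂ) (β : V →ₗ[ℂ] Module.End ℂ M)
    (hβ : ∀ v m, β v (low v m) + ε • low v (β v m) = 0) (φ : L →ₗ[ℂ] M) :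
    ∃ T : Module.End ℂ M, (∀ l, T (top l) = φ l) ∧
      ∀ v m, T (low v m) = β v m + ε • low v (T m) := by
  -- The recursion is encoded as a module structure on pairs `(m, T m)`: `v` sends `(m, m')` to `(v
  -- m, β v m + ε • v m')`. The hypothesis `hβ` says that the second component of the square of this
  -- operator vanishes.
  let F : V →ₗ[ℂ] Module.End ℂ (M × M) :=
    { toFun := fun v => (low v ∘ₗ LinearMap.fst ℂ _ _).prod
        (β v ∘ₗ LinearMap.fst ℂ _ _ + ε • low v ∘ₗ LinearMap.snd ℂ _ _)
      map_add' := fun v w => by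
        refine LinearMap.ext fun m => Prod.ext (by simp) ?_
        simp only [LinearMap.prod_apply, Function.prod_apply, LinearMap.add_apply, map_add,
          LinearMap.comp_apply, LinearMap.smul_apply, smul_add, Prod.snd_add]
        abel
      map_smul' := fun c v => by
        refine LinearMap.ext fun m => Prod.ext (by simp) ?_
        simp only [LinearMap.prod_apply, Function.prod_apply, LinearMap.add_apply, map_smul,
          LinearMap.comp_apply, LinearMap.smul_apply, smul_add, Prod.smul_snd, RingHom.id_apply]
        rw [smul_comm ε c] }
  have F1 : ∀ v m, (F v m).1 = low v m.1 := fun _ _ => rfl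
  have F2 : ∀ v m, (F v m).2 = β v m.1 + ε • low v m.2 := fun _ _ => rfl
  obtain ⟨T, h1, hV⟩ := h.exists_lift F
    (fun v m => Prod.ext (by rw [F1, F1, h.sq_eq_zero]; rfl)
      (by rw [F2, F1, F2, map_add, map_smul, h.sq_eq_zero, smul_zero, add_zero, hβ]; rfl))
    (top.prod φ)
  -- The lift is the graph of an operator, so its second component satisfies the recursion.
  have fst : LinearMap.fst ℂ _ _ ∘ₗ T = LinearMap.id := by
    refine h.hom_ext (fun l => by simp [h1]) fun v m hm => ?_
    change (T (low v m)).1 = low v m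
    rw [hV, F1]
    exact congrArg _ hm
  refine ⟨LinearMap.snd ℂ _ _ ∘ₗ T, fun l => by simp [h1], fun v m => ?_⟩
  change (T (low v m)).2 = _
  rw [hV, F2]
  have : (T m).1 = m := LinearMap.congr_fun fst m
  rw [this]
  rfl

end IsFree

/-! ### Bilinearity of the commutator and the anticommutator -/

section brackets

variable {ι : Type*} [Fintype ι]

theorem matrix_comm_add (A B C : Matrix ι ι ℂ) :
    A * (B + C) - (B + C) * A = (A * B - B * A) + (A * C - C * A) := by
  noncomm_ring

theorem matrix_comm_smul (c : ℂ) (A B : Matrix ι ι ℂ) :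
    A * (c • B) - (c • B) * A = c • (A * B - B * A) := by
  rw [Matrix.mul_smul, Matrix.smul_mul, smul_sub]

theorem matrix_anticomm_add (A B C : Matrix ι ι ℂ) :
    A * (B + C) + (B + C) * A = (A * B + B * A) + (A * C + C * A) := by
  noncomm_ring

theorem matrix_anticomm_smul (c : ℂ) (A B : Matrix ι ι ℂ) :
    A * (c • B) + (c • B) * A = c • (A * B + B * A) := by
  rw [Matrix.mul_smul, Matrix.smul_mul, smul_add]

theorem matrix_add_comm (B C A : Matrix ι ι ℂ) :
    (B + C) * A - A * (B + C) = (B * A - A * B) + (C * A - A * C) := by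
  noncomm_ring

theorem matrix_smul_comm (c : ℂ) (B A : Matrix ι ι ℂ) :
    (c • B) * A - A * (c • B) = c • (B * A - A * B) := by
  rw [Matrix.mul_smul, Matrix.smul_mul, smul_sub]

theorem matrix_add_anticomm (B C A : Matrix ι ι ℂ) :
    (B + C) * A + A * (B + C) = (B * A + A * B) + (C * A + A * C) := by
  noncomm_ring

theorem matrix_smul_anticomm (c : ℂ) (B A : Matrix ι ι ℂ) :
    (c • B) * A + A * (c • B) = c • (B * A + A * B) := by
  rw [Matrix.mul_smul, Matrix.smul_mul, smul_add]

end brackets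

namespace HyperSuperalgebra

variable (G : HyperSuperalgebra)

/-! ### The decomposition by hypercharge -/

/-- The even part of the superalgebra. -/
def evenSub : Submodule ℂ G.carrier where
  carrier := {x | G.Even x}
  add_mem' hx hz := IsEven.add hx hz
  zero_mem' _ _ _ := rfl
  smul_mem' c _ hx := IsEven.smul c hx

/-- The odd elements of hypercharge `1`. -/
def raising : Submodule ℂ G.carrier where
  carrier := {x | G.IsRaising x}
  add_mem' {x z} hx hz := by
    refine ⟨fun i j h => by simp [hx.1 i j h, hz.1 i j h], ?_⟩
    have h1 := hx.2
    have h2 := hz.2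
    rw [Submodule.coe_add]
    linear_combination (norm := noncomm_ring) h1 + h2
  zero_mem' := ⟨fun _ _ _ => rfl, by simp⟩
  smul_mem' c x hx := by
    refine ⟨fun i j h => by simp [hx.1 i j h], ?_⟩
    rw [Submodule.coe_smul, Matrix.mul_smul, Matrix.smul_mul, ← smul_sub, hx.2]

/-- The odd elements of hypercharge `-1`. -/
def lowering : Submodule ℂ G.carrier where
  carrier := {x | G.IsLowering x}
  add_mem' {x z} hx hz := by
    refine ⟨fun i j h => by simp [hx.1 i j h, hz.1 i j h], ?_⟩
    have h1 := hx.2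
    have h2 := hz.2
    rw [Submodule.coe_add]
    linear_combination (norm := noncomm_ring) h1 + h2
  zero_mem' := ⟨fun _ _ _ => rfl, by simp⟩
  smul_mem' c x hx := by
    refine ⟨fun i j h => by simp [hx.1 i j h], ?_⟩
    rw [Submodule.coe_smul, Matrix.mul_smul, Matrix.smul_mul, ← smul_sub, hx.2, smul_neg]

variable {G}

theorem coe_comm (x z : G.carrier) (hx : G.Even x) :
    (G.comm x z hx : Matrix G.idx G.idx ℂ) = x * z - z * x := rfl

theorem coe_anticomm (x z : G.carrier) (hx : G.Odd x) (hz : G.Odd z) :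
    (G.anticomm x z hx hz : Matrix G.idx G.idx ℂ) = x * z + z * x := rfl

theorem even_comm {a z : G.carrier} (ha : G.Even a) (hz : G.Even z) : G.Even (G.comm a z ha) :=
  (ha.mul hz).sub (hz.mul ha)

theorem odd_comm {a z : G.carrier} (ha : G.Even a) (hz : G.Odd z) : G.Odd (G.comm a z ha) :=
  (ha.mul_odd hz).sub (hz.mul_even ha)

theorem even_anticomm {x z : G.carrier} (hx : G.Odd x) (hz : G.Odd z) :
    G.Even (G.anticomm x z hx hz) :=
  (hx.mul hz).add (hz.mul hx)

/-- `Y` commutes with `a`, so bracketing with `a` preserves the hypercharge. -/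
theorem isLowering_comm {a v : G.carrier} (ha : G.Even a) (hv : G.IsLowering v) :
    G.IsLowering (G.comm a v ha) := by
  refine ⟨odd_comm ha hv.1, ?_⟩
  have h := G.Y_comm a a.2 ha
  have k := hv.2
  rw [coe_comm]
  linear_combination (norm := noncomm_ring) h * (v : Matrix G.idx G.idx ℂ)
    + (a : Matrix G.idx G.idx ℂ) * k - (v : Matrix G.idx G.idx ℂ) * h
    - k * (a : Matrix G.idx G.idx ℂ)

theorem isRaising_comm {a u : G.carrier} (ha : G.Even a) (hu : G.IsRaising u) :
    G.IsRaising (G.comm a u ha) := by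
  refine ⟨odd_comm ha hu.1, ?_⟩
  have h := G.Y_comm a a.2 ha
  have k := hu.2
  rw [coe_comm]
  linear_combination (norm := noncomm_ring) h * (u : Matrix G.idx G.idx ℂ)
    + (a : Matrix G.idx G.idx ℂ) * k - (u : Matrix G.idx G.idx ℂ) * h
    - k * (a : Matrix G.idx G.idx ℂ)

/-- The bracket is even, hence commutes with `Y`; but its hypercharge is `-2`. -/
theorem anticomm_lowering {v w : G.carrier} (hv : G.IsLowering v) (hw : G.IsLowering w) :
    G.anticomm v w hv.1 hw.1 = 0 := by
  have h := G.Y_comm _ (G.anticomm v w hv.1 hw.1).2 (even_anticomm hv.1 hw.1)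
  have k := hv.2
  have l := hw.2
  rw [coe_anticomm] at h
  refine Subtype.ext ?_
  rw [coe_anticomm, Submodule.coe_zero]
  have two : (2 : ℂ) • ((v : Matrix G.idx G.idx ℂ) * w + w * v) = 0 := by
    rw [two_smul]
    linear_combination (norm := noncomm_ring) k * (w : Matrix G.idx G.idx ℂ)
      + (v : Matrix G.idx G.idx ℂ) * l + l * (v : Matrix G.idx G.idx ℂ)
      + (w : Matrix G.idx G.idx ℂ) * k - h
  exact (smul_eq_zero_iff_right two_ne_zero).1 two

theorem anticomm_raising {v w : G.carrier} (hv : G.IsRaising v) (hw : G.IsRaising w) :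
    G.anticomm v w hv.1 hw.1 = 0 := by
  have h := G.Y_comm _ (G.anticomm v w hv.1 hw.1).2 (even_anticomm hv.1 hw.1)
  have k := hv.2
  have l := hw.2
  rw [coe_anticomm] at h
  refine Subtype.ext ?_
  rw [coe_anticomm, Submodule.coe_zero]
  have two : (2 : ℂ) • ((v : Matrix G.idx G.idx ℂ) * w + w * v) = 0 := by
    rw [two_smul]
    linear_combination (norm := noncomm_ring) h - k * (w : Matrix G.idx G.idx ℂ)
      - (v : Matrix G.idx G.idx ℂ) * l - l * (v : Matrix G.idx G.idx ℂ)
      - (w : Matrix G.idx G.idx ℂ) * k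
  exact (smul_eq_zero_iff_right two_ne_zero).1 two

variable (G)

/-- The projection to the even part. -/
def projEven : G.carrier →ₗ[ℂ] G.evenSub where
  toFun x := ⟨⟨evenPart G.parity x, G.evenPart_mem x x.2⟩, isEven_evenPart _⟩
  map_add' _ _ := Subtype.ext (Subtype.ext (map_add (evenPart G.parity) _ _))
  map_smul' _ _ := Subtype.ext (Subtype.ext (map_smul (evenPart G.parity) _ _))

/-- The bracket with the hypercharge. -/
def commY : G.carrier →ₗ[ℂ] G.carrier where
  toFun x := G.comm G.Y x G.Y_even
  map_add' _ _ := Subtype.ext (matrix_comm_add _ _ _)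
  map_smul' c _ := Subtype.ext (matrix_comm_smul c _ _)

theorem exists_odd_decomp (x : G.carrier) : ∃ u v, G.IsRaising u ∧ G.IsLowering v ∧
    x - G.projEven x = u + v := by
  have ho : G.Odd (x - G.projEven x) := by
    have e : ((x - G.projEven x : G.carrier) : Matrix G.idx G.idx ℂ) = oddPart G.parity x := rfl
    unfold Odd
    rw [e]
    exact isOdd_oddPart _
  obtain ⟨U, hU, V, hV, h1, h2, h3, h4, h5⟩ := G.odd_decomp _ (x - G.projEven x).2 ho
  exact ⟨⟨U, hU⟩, ⟨V, hV⟩, ⟨h1, h3⟩, ⟨h2, h4⟩, Subtype.ext h5⟩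

theorem commY_raising {u : G.carrier} (hu : G.IsRaising u) : G.commY u = u := Subtype.ext hu.2

theorem commY_lowering {v : G.carrier} (hv : G.IsLowering v) : G.commY v = -v := Subtype.ext hv.2

/-- The projection to the odd elements of hypercharge `1`. -/
noncomputable def projRaising : G.carrier →ₗ[ℂ] G.raising :=
  -- On the odd part `ad Y` has eigenvalues `1` and `-1`, and `(1 + ad Y) / 2` is the spectral
  -- projection to the first.
  LinearMap.codRestrict G.raising ((1 / 2 : ℂ) • ((LinearMap.id + G.commY) ∘ₗ
    (LinearMap.id - G.evenSub.subtype ∘ₗ G.projEven))) fun x => by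
      obtain ⟨u, v, hu, hv, h⟩ := G.exists_odd_decomp x
      have : ((1 / 2 : ℂ) • ((LinearMap.id + G.commY) ∘ₗ
          (LinearMap.id - G.evenSub.subtype ∘ₗ G.projEven))) x = u := by
        change (1 / 2 : ℂ) • ((x - G.projEven x : G.carrier) + G.commY (x - G.projEven x)) = u
        rw [h, map_add, commY_raising G hu, commY_lowering G hv]
        module
      rw [this]
      exact hu

/-- The projection to the odd elements of hypercharge `-1`. -/
noncomputable def projLowering : G.carrier →ₗ[ℂ] G.lowering :=
  LinearMap.codRestrict G.lowering ((1 / 2 : ℂ) • ((LinearMap.id - G.commY) ∘ₗ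
    (LinearMap.id - G.evenSub.subtype ∘ₗ G.projEven))) fun x => by
      obtain ⟨u, v, hu, hv, h⟩ := G.exists_odd_decomp x
      have : ((1 / 2 : ℂ) • ((LinearMap.id - G.commY) ∘ₗ
          (LinearMap.id - G.evenSub.subtype ∘ₗ G.projEven))) x = v := by
        change (1 / 2 : ℂ) • ((x - G.projEven x : G.carrier) - G.commY (x - G.projEven x)) = v
        rw [h, map_add, commY_raising G hu, commY_lowering G hv]
        module
      rw [this]
      exact hv

theorem coe_projRaising (x : G.carrier) : (G.projRaising x : G.carrier)
    = (1 / 2 : ℂ) • ((x - G.projEven x : G.carrier) + G.commY (x - G.projEven x)) := rfl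

theorem coe_projLowering (x : G.carrier) : (G.projLowering x : G.carrier)
    = (1 / 2 : ℂ) • ((x - G.projEven x : G.carrier) - G.commY (x - G.projEven x)) := rfl

theorem proj_add_proj_add_proj (x : G.carrier) :
    (G.projEven x + G.projRaising x + G.projLowering x : G.carrier) = x := by
  rw [coe_projRaising, coe_projLowering]
  module

theorem projEven_even {x : G.carrier} (hx : G.Even x) : (G.projEven x : G.carrier) = x :=
  Subtype.ext (evenPart_of_isEven hx)

theorem projEven_odd {x : G.carrier} (hx : G.Odd x) : G.projEven x = 0 :=
  Subtype.ext (Subtype.ext (evenPart_of_isOdd hx))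

theorem proj_even {x : G.carrier} (hx : G.Even x) :
    G.projEven x = ⟨x, hx⟩ ∧ G.projRaising x = 0 ∧ G.projLowering x = 0 := by
  refine ⟨Subtype.ext (G.projEven_even hx), Subtype.ext ?_, Subtype.ext ?_⟩
  · rw [coe_projRaising, projEven_even G hx, sub_self, map_zero]
    simp
  · rw [coe_projLowering, projEven_even G hx, sub_self, map_zero]
    simp

theorem proj_raising {x : G.carrier} (hx : G.IsRaising x) :
    G.projEven x = 0 ∧ G.projRaising x = ⟨x, hx⟩ ∧ G.projLowering x = 0 := by
  refine ⟨G.projEven_odd hx.1, Subtype.ext ?_, Subtype.ext ?_⟩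
  · rw [coe_projRaising, projEven_odd G hx.1, Submodule.coe_zero, sub_zero, commY_raising G hx]
    module
  · rw [coe_projLowering, projEven_odd G hx.1, Submodule.coe_zero, sub_zero, commY_raising G hx]
    simp

theorem proj_lowering {x : G.carrier} (hx : G.IsLowering x) :
    G.projEven x = 0 ∧ G.projRaising x = 0 ∧ G.projLowering x = ⟨x, hx⟩ := by
  refine ⟨G.projEven_odd hx.1, Subtype.ext ?_, Subtype.ext ?_⟩
  · rw [coe_projRaising, projEven_odd G hx.1, Submodule.coe_zero, sub_zero, commY_lowering G hx]
    simp
  · rw [coe_projLowering, projEven_odd G hx.1, Submodule.coe_zero, sub_zero, commY_lowering G hx]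
    change (1 / 2 : ℂ) • (x - -x) = x
    module

/-- Every element is the sum of an even, a raising and a lowering one. -/
theorem carrier_induction {P : G.carrier → Prop} (x : G.carrier)
    (hadd : ∀ x z, P x → P z → P (x + z)) (h0 : ∀ x, G.Even x → P x)
    (h1 : ∀ x, G.IsRaising x → P x) (h2 : ∀ x, G.IsLowering x → P x) : P x := by
  rw [← G.proj_add_proj_add_proj x]
  exact hadd _ _ (hadd _ _ (h0 _ (G.projEven x).2) (h1 _ (G.projRaising x).2))
    (h2 _ (G.projLowering x).2)

theorem even_of_evenSub (a : G.evenSub) : G.Even a := a.2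

theorem isRaising_of_raising (u : G.raising) : G.IsRaising u := u.2

theorem isLowering_of_lowering (v : G.lowering) : G.IsLowering v := v.2

/-- The action of the even part on the lowering elements. -/
def adLow : G.evenSub →ₗ[ℂ] G.lowering →ₗ[ℂ] G.lowering :=
  LinearMap.mk₂ ℂ (fun a v => ⟨G.comm a v (G.even_of_evenSub a),
      isLowering_comm (G.even_of_evenSub a) (G.isLowering_of_lowering v)⟩)
    (fun _ _ _ => Subtype.ext (Subtype.ext (matrix_add_comm _ _ _)))
    (fun c _ _ => Subtype.ext (Subtype.ext (matrix_smul_comm c _ _)))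
    (fun _ _ _ => Subtype.ext (Subtype.ext (matrix_comm_add _ _ _)))
    (fun c _ _ => Subtype.ext (Subtype.ext (matrix_comm_smul c _ _)))

/-- The bracket of a raising with a lowering element. -/
def pairing : G.raising →ₗ[ℂ] G.lowering →ₗ[ℂ] G.evenSub :=
  LinearMap.mk₂ ℂ (fun u v => ⟨G.anticomm u v (G.isRaising_of_raising u).1
      (G.isLowering_of_lowering v).1,
      even_anticomm (G.isRaising_of_raising u).1 (G.isLowering_of_lowering v).1⟩)
    (fun _ _ _ => Subtype.ext (Subtype.ext (matrix_add_anticomm _ _ _)))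
    (fun c _ _ => Subtype.ext (Subtype.ext (matrix_smul_anticomm c _ _)))
    (fun _ _ _ => Subtype.ext (Subtype.ext (matrix_anticomm_add _ _ _)))
    (fun c _ _ => Subtype.ext (Subtype.ext (matrix_anticomm_smul c _ _)))

theorem coe_adLow (a : G.evenSub) (v : G.lowering) :
    ((G.adLow a v : G.carrier) : Matrix G.idx G.idx ℂ)
      = (a : G.carrier) * (v : G.carrier) - (v : G.carrier) * (a : G.carrier) := rfl

theorem coe_pairing (u : G.raising) (v : G.lowering) :
    ((G.pairing u v : G.carrier) : Matrix G.idx G.idx ℂ)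
      = (u : G.carrier) * (v : G.carrier) + (v : G.carrier) * (u : G.carrier) := rfl

end HyperSuperalgebra

namespace HyperSuperalgebra

variable (G : HyperSuperalgebra)

/-! ### Modules over the even part -/

/-- A functional separates `Y` from the subspace `ss`. It reads off the coefficient of `Y` linearly,
so the decomposition of an even element into `ss` and `ℂ Y` is linear as well. -/
theorem exists_charge : ∃ t : Matrix G.idx G.idx ℂ →ₗ[ℂ] ℂ,
    t G.Y = 1 ∧ ∀ X ∈ G.ss, t X = 0 := by
  obtain ⟨f, hf, h⟩ := G.ss.toSubmodule.exists_le_ker_of_notMem G.Y_notMem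
  exact ⟨(f G.Y)⁻¹ • f, inv_mul_cancel₀ hf, fun X hX => by
    rw [LinearMap.smul_apply, show f X = 0 from h hX, smul_zero]⟩

/-- The coefficient of the hypercharge in an even element. -/
noncomputable def charge : Matrix G.idx G.idx ℂ →ₗ[ℂ] ℂ := G.exists_charge.choose

theorem charge_Y : G.charge G.Y = 1 := G.exists_charge.choose_spec.1

theorem charge_ss {X : Matrix G.idx G.idx ℂ} (hX : X ∈ G.ss) : G.charge X = 0 :=
  G.exists_charge.choose_spec.2 X hX

/-- The component of an even element in the semisimple part. -/
noncomputable def ssPart : G.evenSub →ₗ[ℂ] G.ss where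
  toFun a := ⟨(a : G.carrier) - G.charge (a : G.carrier) • (G.Y : Matrix G.idx G.idx ℂ), by
    obtain ⟨S, hS, t, h⟩ := G.even_decomp _ a.1.2 a.2
    rw [h, map_add, map_smul, charge_ss G hS, charge_Y, zero_add, smul_eq_mul, mul_one,
      add_sub_cancel_right]
    exact hS⟩
  map_add' a b := Subtype.ext (by
    change ((a : G.carrier) + (b : G.carrier) : Matrix G.idx G.idx ℂ)
      - G.charge ((a : G.carrier) + (b : G.carrier) : Matrix G.idx G.idx ℂ) • _
      = (_ - _ • _) + (_ - _ • _)
    rw [map_add]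
    module)
  map_smul' c a := Subtype.ext (by
    change (c • (a : G.carrier) : Matrix G.idx G.idx ℂ)
      - G.charge (c • (a : G.carrier) : Matrix G.idx G.idx ℂ) • _ = c • (_ - _ • _)
    rw [map_smul, smul_eq_mul]
    module)

theorem coe_ssPart (a : G.evenSub) : (G.ssPart a : Matrix G.idx G.idx ℂ)
    = (a : G.carrier) - G.charge (a : G.carrier) • (G.Y : Matrix G.idx G.idx ℂ) := rfl

/-- The multiples of `Y` drop out because `Y` centralizes the even part. -/
theorem comm_eq_ssPart (a b : G.evenSub) :
    ((a : G.carrier) * (b : G.carrier) - (b : G.carrier) * (a : G.carrier) :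
      Matrix G.idx G.idx ℂ) = (⁅G.ssPart a, G.ssPart b⁆ : G.ss) := by
  change _ = (G.ssPart a : Matrix G.idx G.idx ℂ) * G.ssPart b - G.ssPart b * G.ssPart a
  have ha := G.Y_comm _ a.1.2 a.2
  have hb := G.Y_comm _ b.1.2 b.2
  rw [coe_ssPart, coe_ssPart]
  generalize G.charge _ = s
  generalize G.charge _ = t
  simp only [mul_sub, sub_mul, smul_mul_assoc, mul_smul_comm, ha, hb]
  module

/-- The recursion with sign `-1`, started from zero on `L`. It needs only that the even part acts by
derivations with respect to the lowering operators; linearity in `u` follows from uniqueness. -/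
theorem exists_modelRaising {L M : Type u} [AddCommGroup L] [Module ℂ L] [AddCommGroup M]
    [Module ℂ M] {low : G.lowering →ₗ[ℂ] Module.End ℂ M} {top : L →ₗ[ℂ] M}
    (free : IsFree low top) (H : G.evenSub →ₗ[ℂ] Module.End ℂ M)
    (hH : ∀ a v m,
      H a (low v m) = low (G.adLow a v) m + low v (H a m)) :
    ∃ U : G.raising →ₗ[ℂ] Module.End ℂ M,
    (∀ u l, U u (top l) = 0) ∧
    ∀ u v m, U u (low v m) = H (G.pairing u v) m - low v (U u m) := by
  have ex : ∀ u : G.raising, ∃ T : Module.End ℂ M,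
      (∀ l : L, T (top l) = 0) ∧
      ∀ v m, T (low v m) = H (G.pairing u v) m - low v (T m) := by
    intro u
    obtain ⟨T, h1, h2⟩ := free.exists_rec (-1) (H ∘ₗ G.pairing u)
      (fun v m => by
        -- Consistency of the recursion amounts to `[{u, v}, v] = u v² - v² u = 0`, where `v² = 0`
        -- as a matrix because `{v, v} = 0`.
        have e : G.adLow (G.pairing u v) v = 0 := by
          have hv := congrArg (Subtype.val) (anticomm_lowering
            (G.isLowering_of_lowering v) (G.isLowering_of_lowering v))
          rw [coe_anticomm, Submodule.coe_zero, ← two_smul ℂ,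
            smul_eq_zero_iff_right two_ne_zero] at hv
          refine Subtype.ext (Subtype.ext ?_)
          rw [coe_adLow, coe_pairing]
          change _ = (0 : Matrix G.idx G.idx ℂ)
          linear_combination (norm := noncomm_ring) ((u : G.carrier) : Matrix G.idx G.idx ℂ) * hv
            - hv * ((u : G.carrier) : Matrix G.idx G.idx ℂ)
        change H (G.pairing u v) (low v m)
          + (-1 : ℂ) • low v (H (G.pairing u v) m) = 0
        rw [hH, e, map_zero, LinearMap.zero_apply]
        module) 0
    exact ⟨T, h1, fun v m => by
      rw [h2, neg_one_smul, ← sub_eq_add_neg]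
      rfl⟩
  choose U h1 h2 using ex
  refine ⟨IsLinearMap.mk' U ⟨fun a b => ?_, fun c a => ?_⟩, h1, h2⟩
  · refine free.hom_ext (fun l => ?_) fun v m hm => ?_
    · change U (a + b) (top l) = U a (top l) + U b (top l)
      rw [h1, h1, h1, add_zero]
    · simp only [LinearMap.add_apply, h2, map_add] at hm ⊢
      rw [hm, map_add]
      abel
  · refine free.hom_ext (fun l => ?_) fun v m hm => ?_
    · change U (c • a) (top l) = c • U a (top l)
      rw [h1, h1, smul_zero]
    · simp only [LinearMap.smul_apply, h2, map_smul] at hm ⊢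
      rw [hm, map_smul, smul_sub]

variable (L : Type u) [AddCommGroup L] [Module ℂ L] [LieRingModule G.ss L] [LieModule ℂ G.ss L]

/-- The action of the even part on `L`, on which the hypercharge acts as the scalar `y`. -/
noncomputable def evenAct (y : ℂ) : G.evenSub →ₗ[ℂ] Module.End ℂ L :=
  (LieModule.toEnd ℂ G.ss L : G.ss →ₗ[ℂ] Module.End ℂ L) ∘ₗ G.ssPart
    + y • (G.charge ∘ₗ G.carrier.subtype ∘ₗ G.evenSub.subtype).smulRight 1

theorem evenAct_apply (y : ℂ) (a : G.evenSub) (l : L) :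
    G.evenAct L y a l = ⁅G.ssPart a, l⁆ + (y * G.charge (a : G.carrier)) • l := by
  simp [evenAct, mul_smul]

theorem evenAct_ss (y : ℂ) (x : G.ss) (h : G.Even (G.ofSS x)) (l : L) :
    G.evenAct L y ⟨G.ofSS x, h⟩ l = ⁅x, l⁆ := by
  have h0 : G.charge (G.ofSS x) = 0 := G.charge_ss x.2
  have h1 : G.ssPart ⟨G.ofSS x, h⟩ = x := Subtype.ext (by
    rw [coe_ssPart, h0, zero_smul, sub_zero]; rfl)
  rw [evenAct_apply, h0, h1, mul_zero, zero_smul, add_zero]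

theorem evenAct_Y (y : ℂ) (h : G.Even G.Y) (l : L) :
    G.evenAct L y ⟨G.Y, h⟩ l = y • l := by
  have h1 : G.ssPart ⟨G.Y, h⟩ = 0 := Subtype.ext (by
    rw [coe_ssPart, charge_Y, one_smul, sub_self]; rfl)
  rw [evenAct_apply, charge_Y, h1, mul_one, zero_lie, zero_add]

/-- `Y` acts by a scalar and the bracket has no component along `Y`, so only the `ss`-module
structure matters. -/
theorem evenAct_comm (y : ℂ) (a b : G.evenSub) (h) (l : L) :
    G.evenAct L y ⟨G.comm a b (G.even_of_evenSub a), h⟩ l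
      = G.evenAct L y a (G.evenAct L y b l) - G.evenAct L y b (G.evenAct L y a l) := by
  have e := G.comm_eq_ssPart a b
  have h0 : G.charge (G.comm a b (G.even_of_evenSub a)) = 0 := by
    rw [coe_comm, e]
    exact G.charge_ss (Subtype.prop _)
  have h1 : G.ssPart ⟨G.comm a b (G.even_of_evenSub a), h⟩ = ⁅G.ssPart a, G.ssPart b⁆ :=
    Subtype.ext (by
    rw [coe_ssPart, h0, zero_smul, sub_zero, ← e]; rfl)
  rw [evenAct_apply, h0, h1, mul_zero, zero_smul, add_zero]
  simp only [evenAct_apply, lie_add, lie_smul, smul_add, lie_lie]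
  rw [smul_comm (y * G.charge (a : G.carrier)) (y * G.charge (b : G.carrier))]
  abel

theorem evenAct_affine (y : ℂ) (a : G.evenSub) (l : L) :
    G.evenAct L y a l
      = G.evenAct L 0 a l + y • (G.evenAct L 1 a l - G.evenAct L 0 a l) := by
  simp only [evenAct_apply]
  module

/-! ### The action on the free module -/

variable {M : Type u} [AddCommGroup M] [Module ℂ M]
  {low : G.lowering →ₗ[ℂ] Module.End ℂ M} {top : L →ₗ[ℂ] M}

/-- The recursion with sign `1`: an even element acts as a derivation extending its action on `L`.
Consistency is the anticommutation of `[a, v]` with `v`. -/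
theorem exists_modelEven (free : IsFree low top) (y : ℂ) : ∃ H : G.evenSub →ₗ[ℂ] Module.End ℂ M,
    (∀ a l, H a (top l) = top (G.evenAct L y a l)) ∧
    ∀ a v m, H a (low v m) = low (G.adLow a v) m + low v (H a m) := by
  have ex : ∀ a : G.evenSub, ∃ T : Module.End ℂ M,
      (∀ l : L, T (top l) = top (G.evenAct L y a l)) ∧
      ∀ v m, T (low v m) = low (G.adLow a v) m + low v (T m) := by
    intro a
    obtain ⟨T, h1, h2⟩ := free.exists_rec 1 (low ∘ₗ G.adLow a)
      (fun v m => by rw [one_smul]; exact free.anticomm _ _ _)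
      (top ∘ₗ G.evenAct L y a)
    exact ⟨T, h1, fun v m => by rw [h2, one_smul]; rfl⟩
  choose H h1 h2 using ex
  refine ⟨IsLinearMap.mk' H ⟨fun a b => ?_, fun c a => ?_⟩, h1, h2⟩
  · refine free.hom_ext (fun l => ?_) fun v m hm => ?_
    · change H (a + b) (top l) = H a (top l) + H b (top l)
      rw [h1, h1, h1, map_add, LinearMap.add_apply, map_add]
    · simp only [LinearMap.add_apply, h2, map_add] at hm ⊢
      rw [hm, map_add]
      abel
  · refine free.hom_ext (fun l => ?_) fun v m hm => ?_
    · change H (c • a) (top l) = c • H a (top l)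
      rw [h1, h1, map_smul, LinearMap.smul_apply, map_smul]
    · simp only [LinearMap.smul_apply, h2, map_smul] at hm ⊢
      rw [hm, map_smul, smul_add]

/-- The recursive description of the action on the free module. -/
structure IsModelAct (low : G.lowering →ₗ[ℂ] Module.End ℂ M) (top : L →ₗ[ℂ] M) (y : ℂ)
    (A : G.carrier →ₗ[ℂ] Module.End ℂ M) : Prop where
  low_eq : ∀ v : G.lowering, A v = low v
  even_top : ∀ (a : G.evenSub) l, A a (top l) = top (G.evenAct L y a l)
  raising_top : ∀ (u : G.raising) l, A u (top l) = 0
  even_low : ∀ (a : G.evenSub) (v : G.lowering) m,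
    A a (A v m) = A (G.comm a v (G.even_of_evenSub a)) m + A v (A a m)
  raising_low : ∀ (u : G.raising) (v : G.lowering) m,
    A u (A v m) = A (G.anticomm u v (G.isRaising_of_raising u).1
      (G.isLowering_of_lowering v).1) m - A v (A u m)

theorem exists_isModelAct (free : IsFree low top) (y : ℂ) : ∃ A, G.IsModelAct L low top y A := by
  obtain ⟨H, h1, h2⟩ := G.exists_modelEven L free y
  obtain ⟨U, h3, h4⟩ := G.exists_modelRaising free H h2
  let A : G.carrier →ₗ[ℂ] Module.End ℂ M :=
    H ∘ₗ G.projEven + U ∘ₗ G.projRaising + low ∘ₗ G.projLowering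
  have A0 : ∀ a : G.evenSub, A a = H a := fun a => by
    obtain ⟨e1, e2, e3⟩ := G.proj_even a.2
    simp [A, e1, e2, e3]
  have A1 : ∀ u : G.raising, A u = U u := fun u => by
    obtain ⟨e1, e2, e3⟩ := G.proj_raising u.2
    simp [A, e1, e2, e3]
  have A2 : ∀ v : G.lowering, A v = low v := fun v => by
    obtain ⟨e1, e2, e3⟩ := G.proj_lowering v.2
    simp [A, e1, e2, e3]
  refine ⟨A, A2, fun a l => by rw [A0, h1], fun u l => by rw [A1, h3], fun a v m => ?_,
    fun u v m => ?_⟩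
  · rw [A0, A2, h2, ← A2 (G.adLow a v)]
    rfl
  · rw [A1, A2, h4, ← A0 (G.pairing u v)]
    rfl

end HyperSuperalgebra

namespace HyperSuperalgebra

variable {G : HyperSuperalgebra}

/-! ### The defining relations -/

/-- `A` respects the superbracket. -/
structure IsAction {B : Type*} [Ring B] [Algebra ℂ B] (A : G.carrier →ₗ[ℂ] B) : Prop where
  comm : ∀ x z (hx : G.Even x), A (G.comm x z hx) = A x * A z - A z * A x
  anticomm : ∀ x z (hx : G.Odd x) (hz : G.Odd z),
    A (G.anticomm x z hx hz) = A x * A z + A z * A x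

theorem odd_induction {P : G.carrier → Prop} {x : G.carrier} (hx : G.Odd x)
    (h : ∀ u v, G.IsRaising u → G.IsLowering v → P (u + v)) : P x := by
  have := h _ _ (G.projRaising x).2 (G.projLowering x).2
  have e := G.proj_add_proj_add_proj x
  rw [G.projEven_odd hx, Submodule.coe_zero, zero_add] at e
  rwa [e] at this

/-- Both brackets are bilinear, so homogeneous arguments suffice. In `h11` and `h22` the left side
of the relation has become zero, since two elements of the same nonzero hypercharge anticommute. -/
theorem isAction_of_homogeneous {B : Type*} [Ring B] [Algebra ℂ B] {A : G.carrier →ₗ[ℂ] B}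
    (h00 : ∀ a b (ha : G.Even a), G.Even b → A (G.comm a b ha) = A a * A b - A b * A a)
    (h01 : ∀ a u (ha : G.Even a), G.IsRaising u → A (G.comm a u ha) = A a * A u - A u * A a)
    (h02 : ∀ a v (ha : G.Even a), G.IsLowering v → A (G.comm a v ha) = A a * A v - A v * A a)
    (h11 : ∀ u w, G.IsRaising u → G.IsRaising w → A u * A w + A w * A u = 0)
    (h12 : ∀ u v (hu : G.IsRaising u) (hv : G.IsLowering v),
      A (G.anticomm u v hu.1 hv.1) = A u * A v + A v * A u)
    (h22 : ∀ v w, G.IsLowering v → G.IsLowering w → A v * A w + A w * A v = 0) :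
    IsAction A := by
  refine ⟨fun x z hx => ?_, fun x z hx hz => ?_⟩
  · refine G.carrier_induction (P := fun z => A (G.comm x z hx) = A x * A z - A z * A x) z
      (fun z w hz hw => ?_) (h00 x · hx) (h01 x · hx) (h02 x · hx)
    have e : G.comm x (z + w) hx = G.comm x z hx + G.comm x w hx :=
      Subtype.ext (matrix_comm_add _ _ _)
    rw [e, map_add, map_add, hz, hw]
    noncomm_ring
  · revert hx hz
    intro hx
    -- The bracket carries proofs of oddness, so the predicate quantifies over them.
    refine odd_induction (P := fun x => ∀ (hx : G.Odd x) (hz : G.Odd z),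
      A (G.anticomm x z hx hz) = A x * A z + A z * A x) hx (fun u v hu hv hx hz => ?_) hx
    revert hz
    intro hz
    refine odd_induction (P := fun z => ∀ (hz : G.Odd z),
      A (G.anticomm (u + v) z hx hz) = A (u + v) * A z + A z * A (u + v)) hz
      (fun u' v' hu' hv' hz => ?_) hz
    have e : G.anticomm (u + v) (u' + v') hx hz
        = G.anticomm u u' hu.1 hu'.1 + G.anticomm u v' hu.1 hv'.1
          + G.anticomm u' v hu'.1 hv.1 + G.anticomm v v' hv.1 hv'.1 := by
      refine Subtype.ext ?_
      change ((u : Matrix G.idx G.idx ℂ) + v) * ((u' : Matrix G.idx G.idx ℂ) + v')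
        + ((u' : Matrix G.idx G.idx ℂ) + v') * ((u : Matrix G.idx G.idx ℂ) + v)
        = (u * u' + u' * u) + (u * v' + v' * u) + (u' * v + v * u') + (v * v' + v' * v)
      noncomm_ring
    rw [e, anticomm_raising hu hu', anticomm_lowering hv hv', zero_add, add_zero, map_add,
      h12 u v' hu hv', h12 u' v hu' hv, map_add, map_add]
    linear_combination (norm := noncomm_ring) -h11 u u' hu hu' - h22 v v' hv hv'

/-- An action that is affine in a parameter `z`, by comparison of the powers of `z`. -/
theorem IsAction.comm_coeff {R : Type*} [Ring R] [Algebra ℂ R] {A B : G.carrier →ₗ[ℂ] R}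
    (h : ∀ z : ℂ, IsAction (A + z • B)) (x z) (hx : G.Even x) :
    B x * B z - B z * B x = 0 ∧
    B (G.comm x z hx) = A x * B z + B x * A z - A z * B x - B z * A x := by
  have e0 := (h 0).comm x z hx
  have e1 := (h 1).comm x z hx
  have e2 := (h (-1)).comm x z hx
  simp only [LinearMap.add_apply, LinearMap.neg_apply, zero_smul, add_zero, one_smul,
    neg_one_smul] at e0 e1 e2
  -- The second difference of the relation at the parameters `1, 0, -1` isolates twice the quadratic
  -- coefficient.
  have two : (2 : ℂ) • (B x * B z - B z * B x) = 0 := by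
    rw [two_smul]
    linear_combination (norm := noncomm_ring) 2 * e0 - e1 - e2
  have key := (smul_eq_zero_iff_right two_ne_zero).1 two
  refine ⟨key, ?_⟩
  linear_combination (norm := noncomm_ring) e1 - e0 + key

theorem IsAction.anticomm_coeff {R : Type*} [Ring R] [Algebra ℂ R] {A B : G.carrier →ₗ[ℂ] R}
    (h : ∀ z : ℂ, IsAction (A + z • B)) (x z) (hx : G.Odd x) (hz : G.Odd z) :
    B x * B z + B z * B x = 0 ∧
    B (G.anticomm x z hx hz) = A x * B z + B x * A z + A z * B x + B z * A x := by
  have e0 := (h 0).anticomm x z hx hz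
  have e1 := (h 1).anticomm x z hx hz
  have e2 := (h (-1)).anticomm x z hx hz
  simp only [LinearMap.add_apply, LinearMap.neg_apply, zero_smul, add_zero, one_smul,
    neg_one_smul] at e0 e1 e2
  have two : (2 : ℂ) • (B x * B z + B z * B x) = 0 := by
    rw [two_smul]
    linear_combination (norm := noncomm_ring) 2 * e0 - e1 - e2
  have key := (smul_eq_zero_iff_right two_ne_zero).1 two
  refine ⟨key, ?_⟩
  linear_combination (norm := noncomm_ring) e1 - e0 + key

/-! ### The superbracket relations on the free module, by recursion along the lowering elements -/

namespace IsModelAct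

variable {L : Type u} [AddCommGroup L] [Module ℂ L] [LieRingModule G.ss L] [LieModule ℂ G.ss L]
  {M : Type u} [AddCommGroup M] [Module ℂ M]
  {low : G.lowering →ₗ[ℂ] Module.End ℂ M} {top : L →ₗ[ℂ] M}
  {y : ℂ} {A : G.carrier →ₗ[ℂ] Module.End ℂ M}

theorem hom_ext (free : IsFree low top) (hA : G.IsModelAct L low top y A)
    {X : Type*} [AddCommGroup X] [Module ℂ X] {f g : M →ₗ[ℂ] X} (h1 : ∀ l, f (top l) = g (top l))
    (hV : ∀ v, G.IsLowering v → ∀ m, f m = g m → f (A v m) = g (A v m)) : f = g :=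
  free.hom_ext h1 fun v m hm => by
    rw [← hA.low_eq]
    exact hV v (G.isLowering_of_lowering v) m hm

theorem comm_low (hA : G.IsModelAct L low top y A) {a v : G.carrier} (ha : G.Even a)
    (hv : G.IsLowering v) (m : M) : A a (A v m) = A (G.comm a v ha) m + A v (A a m) :=
  hA.even_low ⟨a, ha⟩ ⟨v, hv⟩ m

theorem anticomm_low (hA : G.IsModelAct L low top y A) {u v : G.carrier} (hu : G.IsRaising u)
    (hv : G.IsLowering v) (m : M) :
    A u (A v m) = A (G.anticomm u v hu.1 hv.1) m - A v (A u m) :=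
  hA.raising_low ⟨u, hu⟩ ⟨v, hv⟩ m

/-- On `L` the relation is that of the even module; it passes from `m` to `v m` by the Jacobi
identity for `a, b, v`. -/
theorem comm_even (free : IsFree low top) (hA : G.IsModelAct L low top y A) (a b : G.carrier)
    (ha : G.Even a) (hb : G.Even b) : A (G.comm a b ha) = A a * A b - A b * A a := by
  refine hA.hom_ext free (fun l => ?_) fun v hv m hm => ?_
  · have h0 := hA.even_top ⟨G.comm a b ha, even_comm ha hb⟩ l
    have h1 := hA.even_top ⟨a, ha⟩
    have h2 := hA.even_top ⟨b, hb⟩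
    simp only at h0 h1 h2
    rw [h0, LinearMap.sub_apply, Module.End.mul_apply, Module.End.mul_apply, h1, h2, h1, h2,
      ← map_sub]
    exact congrArg top (G.evenAct_comm L y ⟨a, ha⟩ ⟨b, hb⟩ _ l)
  · have jacobi : G.comm (G.comm a b ha) v (even_comm ha hb)
        = G.comm a (G.comm b v hb) ha - G.comm b (G.comm a v ha) hb := by
      refine Subtype.ext ?_
      rw [Submodule.coe_sub]
      simp only [coe_comm]
      noncomm_ring
    rw [hA.comm_low (even_comm ha hb) hv, hm, jacobi]
    simp only [LinearMap.sub_apply, Module.End.mul_apply, hA.comm_low hb hv, hA.comm_low ha hv,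
      map_add, map_sub, hA.comm_low hb (isLowering_comm ha hv),
      hA.comm_low ha (isLowering_comm hb hv)]
    abel

/-- Both sides vanish on `L`. The passage to `v m` uses the Jacobi identity for `a, u, v` and
`comm_even` for `a` and `{u, v}`. -/
theorem comm_raising (free : IsFree low top) (hA : G.IsModelAct L low top y A)
    (a u : G.carrier) (ha : G.Even a) (hu : G.IsRaising u) :
    A (G.comm a u ha) = A a * A u - A u * A a := by
  refine hA.hom_ext free (fun l => ?_) fun v hv m hm => ?_
  · have h0 := hA.raising_top ⟨G.comm a u ha, isRaising_comm ha hu⟩ l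
    have h1 := hA.even_top ⟨a, ha⟩
    have h2 := hA.raising_top ⟨u, hu⟩
    simp only at h0 h1 h2
    rw [h0, LinearMap.sub_apply, Module.End.mul_apply, Module.End.mul_apply, h1, h2, h2, map_zero,
      sub_zero]
  · have jacobi : G.comm a (G.anticomm u v hu.1 hv.1) ha
        = G.anticomm (G.comm a u ha) v (odd_comm ha hu.1) hv.1
          + G.anticomm u (G.comm a v ha) hu.1 (odd_comm ha hv.1) := by
      refine Subtype.ext ?_
      rw [Submodule.coe_add]
      simp only [coe_comm, coe_anticomm]
      noncomm_ring
    have h00 := LinearMap.congr_fun (hA.comm_even free a _ ha (even_anticomm hu.1 hv.1)) m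
    rw [jacobi, map_add] at h00
    simp only [LinearMap.add_apply, LinearMap.sub_apply, Module.End.mul_apply] at h00
    rw [hA.anticomm_low (isRaising_comm ha hu) hv, hm]
    simp only [LinearMap.sub_apply, Module.End.mul_apply, hA.anticomm_low hu hv,
      hA.comm_low ha hv, map_add, map_sub, hA.anticomm_low hu (isLowering_comm ha hv)]
    rw [← sub_eq_zero] at h00 ⊢
    rw [← h00]
    abel

/-- On `v m` the even elements `{u, v}` and `{w, v}` appear and are moved past the raising operators
by `comm_raising`. What remains is `[{u, v}, w] + [{w, v}, u]`, which is zero since `{u, w} = 0`. -/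
theorem anticomm_raising_eq_zero (free : IsFree low top) (hA : G.IsModelAct L low top y A)
    (u w : G.carrier) (hu : G.IsRaising u) (hw : G.IsRaising w) :
    A u * A w + A w * A u = 0 := by
  refine hA.hom_ext free (fun l => ?_) fun v hv m hm => ?_
  · have h1 := hA.raising_top ⟨u, hu⟩
    have h2 := hA.raising_top ⟨w, hw⟩
    simp only at h1 h2
    rw [LinearMap.add_apply, Module.End.mul_apply, Module.End.mul_apply, h1, h2, map_zero,
      map_zero, add_zero]
    rfl
  · have jacobi : G.comm (G.anticomm u v hu.1 hv.1) w (even_anticomm hu.1 hv.1)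
        + G.comm (G.anticomm w v hw.1 hv.1) u (even_anticomm hw.1 hv.1) = 0 := by
      have huw := congrArg Subtype.val (anticomm_raising hu hw)
      rw [coe_anticomm, Submodule.coe_zero] at huw
      refine Subtype.ext ?_
      rw [Submodule.coe_add, Submodule.coe_zero]
      simp only [coe_comm, coe_anticomm]
      linear_combination (norm := noncomm_ring) (v : Matrix G.idx G.idx ℂ) * huw
        - huw * (v : Matrix G.idx G.idx ℂ)
    have h := LinearMap.congr_fun (congrArg A jacobi) m
    rw [map_add, hA.comm_raising free _ w _ hw, hA.comm_raising free _ u _ hu, map_zero] at h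
    simp only [LinearMap.add_apply, LinearMap.sub_apply, Module.End.mul_apply,
      LinearMap.zero_apply] at h hm ⊢
    simp only [hA.anticomm_low hu hv, hA.anticomm_low hw hv, map_sub]
    have hm' := congrArg (A v) hm
    rw [map_add, map_zero] at hm'
    linear_combination (norm := abel) hm' - h

theorem isAction (free : IsFree low top) (hA : G.IsModelAct L low top y A) : IsAction A := by
  refine isAction_of_homogeneous (hA.comm_even free) (hA.comm_raising free)
    (fun a v ha hv => LinearMap.ext fun m => ?_) (hA.anticomm_raising_eq_zero free)
    (fun u v hu hv => LinearMap.ext fun m => ?_) (fun v w hv hw => LinearMap.ext fun m => ?_)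
  · rw [LinearMap.sub_apply, Module.End.mul_apply, Module.End.mul_apply, hA.comm_low ha hv,
      add_sub_cancel_right]
  · rw [LinearMap.add_apply, Module.End.mul_apply, Module.End.mul_apply, hA.anticomm_low hu hv,
      sub_add_cancel]
  · have h1 := hA.low_eq ⟨v, hv⟩
    have h2 := hA.low_eq ⟨w, hw⟩
    simp only at h1 h2
    rw [LinearMap.add_apply, Module.End.mul_apply, Module.End.mul_apply, h1, h2,
      free.anticomm]
    rfl

end IsModelAct

end HyperSuperalgebra

namespace HyperSuperalgebra

variable {G : HyperSuperalgebra}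

/-! ### Modules over the enveloping algebra -/

theorem env_comm (x z : G.carrier) (hx : G.Even x) :
    G.env (G.comm x z hx) = G.env x * G.env z - G.env z * G.env x := by
  have := RingQuot.mkAlgHom_rel ℂ (EnvRel.even x z hx)
  rwa [map_sub, map_mul, map_mul] at this

theorem env_anticomm (x z : G.carrier) (hx : G.Odd x) (hz : G.Odd z) :
    G.env (G.anticomm x z hx hz) = G.env x * G.env z + G.env z * G.env x := by
  have := RingQuot.mkAlgHom_rel ℂ (EnvRel.odd x z hx hz)
  rwa [map_add, map_mul, map_mul] at this

theorem env_mul_self {v : G.carrier} (hv : G.IsLowering v) : G.env v * G.env v = 0 := by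
  have := env_anticomm v v hv.1 hv.1
  rw [anticomm_lowering hv hv, map_zero] at this
  have h2 : (2 : ℂ) • (G.env v * G.env v) = 0 := by rw [two_smul, ← this]
  exact (smul_eq_zero_iff_right two_ne_zero).1 h2

variable (G) in
theorem adjoin_env : Algebra.adjoin ℂ (Set.range G.env) = ⊤ := by
  have h : Set.range G.env = RingQuot.mkAlgHom ℂ G.EnvRel '' Set.range (TensorAlgebra.ι ℂ) := by
    rw [← Set.range_comp]
    rfl
  have h1 : Algebra.adjoin ℂ (RingQuot.mkAlgHom ℂ G.EnvRel '' Set.range (TensorAlgebra.ι ℂ))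
      = ⊤ := by
    rw [← AlgHom.map_adjoin, TensorAlgebra.adjoin_range_ι, Algebra.map_top,
      AlgHom.range_eq_top]
    exact RingQuot.mkAlgHom_surjective ℂ G.EnvRel
  rw [h]
  exact h1

section lift

variable {B : Type*} [Ring B] [Algebra ℂ B] {A : G.carrier →ₗ[ℂ] B}

/-- The action of the enveloping algebra. -/
noncomputable def IsAction.lift (hA : IsAction A) : G.Env →ₐ[ℂ] B :=
  RingQuot.liftAlgHom ℂ ⟨TensorAlgebra.lift ℂ A, by
    intro a b h
    cases h with
    | even x z hx => simp [hA.comm]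
    | odd x z hx hz => simp [hA.anticomm]⟩

theorem IsAction.lift_env (hA : IsAction A) (x : G.carrier) : hA.lift (G.env x) = A x := by
  have := RingQuot.liftAlgHom_mkAlgHom_apply ℂ (TensorAlgebra.lift ℂ A)
    (s := G.EnvRel) (by
    intro a b h
    cases h with
    | even x z hx => simp [hA.comm]
    | odd x z hx hz => simp [hA.anticomm]) (TensorAlgebra.ι ℂ x)
  rw [TensorAlgebra.lift_ι_apply] at this
  exact this

end lift

/-! ### Identification of the Kac module with the free module -/

section kac

variable (G) (L : Type u) [AddCommGroup L] [Module ℂ L] [LieRingModule G.ss L]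

/-- The inclusion of `L` in the Kac module. -/
noncomputable def topMap (y : ℂ) : L →ₗ[ℂ] G.Kac L y :=
  ((G.kacRel L y).mkQ.restrictScalars ℂ) ∘ₗ TensorProduct.mk ℂ G.Env L 1

theorem topMap_apply (y : ℂ) (l : L) : G.topMap L y l = G.top L y l := rfl

theorem act_apply (y : ℂ) (x : G.carrier) (k : G.Kac L y) : G.act L y x k = G.env x • k := rfl

theorem ss_smul_top (y : ℂ) (x : G.ss) (l : L) :
    G.env (G.ofSS x) • G.top L y l = G.top L y ⁅x, l⁆ := by
  rw [top, top, ← map_smul, ← sub_eq_zero, ← map_sub, Submodule.mkQ_apply,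
    Submodule.Quotient.mk_eq_zero]
  refine Submodule.subset_span (Or.inl ⟨x, l, ?_⟩)
  rw [TensorProduct.smul_tmul', smul_eq_mul, mul_one]

theorem Y_smul_top (y : ℂ) (l : L) : G.env G.Y • G.top L y l = y • G.top L y l := by
  refine Eq.trans ?_ ((G.topMap L y).map_smul y l)
  rw [topMap_apply, top, top, ← map_smul, ← sub_eq_zero, ← map_sub, Submodule.mkQ_apply,
    Submodule.Quotient.mk_eq_zero]
  refine Submodule.subset_span (Or.inr (Or.inl ⟨l, ?_⟩))
  rw [TensorProduct.smul_tmul', smul_eq_mul, mul_one]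

theorem raising_smul_top (y : ℂ) {u : G.carrier} (hu : G.IsRaising u) (l : L) :
    G.env u • G.top L y l = 0 := by
  rw [top, ← map_smul, Submodule.mkQ_apply, Submodule.Quotient.mk_eq_zero]
  refine Submodule.subset_span (Or.inr (Or.inr ⟨u, l, hu, ?_⟩))
  rw [TensorProduct.smul_tmul', smul_eq_mul, mul_one]

variable [LieModule ℂ G.ss L]

theorem even_smul_top (y : ℂ) (a : G.evenSub) (l : L) :
    G.env a • G.top L y l = G.top L y (G.evenAct L y a l) := by
  have e : (a : G.carrier) = G.ofSS (G.ssPart a) + G.charge (a : G.carrier) • G.Y :=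
    Subtype.ext (by
      change _ = (G.ssPart a : Matrix G.idx G.idx ℂ)
        + G.charge (a : G.carrier) • (G.Y : Matrix G.idx G.idx ℂ)
      rw [coe_ssPart, sub_add_cancel])
  have h : ∀ (l l' : L) (c : ℂ), G.top L y (l + c • l') = G.top L y l + c • G.top L y l' :=
    fun l l' c => by
      simp only [← topMap_apply, map_add, map_smul]
  conv_lhs => rw [e]
  rw [evenAct_apply, h, map_add, map_smul, add_smul, ss_smul_top, smul_assoc, Y_smul_top,
    smul_smul, mul_comm]

variable {G L} {M : Type u} [AddCommGroup M] [Module ℂ M]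
  {low : G.lowering →ₗ[ℂ] Module.End ℂ M} {top : L →ₗ[ℂ] M}
  {y : ℂ} {A : G.carrier →ₗ[ℂ] Module.End ℂ M}

/-- The map `c ⊗ l ↦ c · top l` kills the generators of `kacRel`, which are the values prescribed on
`L`, and it is equivariant, so it kills the submodule they span. -/
theorem IsModelAct.exists_ofKac (free : IsFree low top) (hA : G.IsModelAct L low top y A) :
    ∃ Φ : G.Kac L y →ₗ[ℂ] M, (∀ l, Φ (G.top L y l) = top l) ∧
      ∀ x k, Φ (G.env x • k) = A x (Φ k) := by
  have hact := hA.isAction free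
  let ψ : G.Env ⊗[ℂ] L →ₗ[ℂ] M :=
    TensorProduct.lift (LinearMap.lcomp ℂ M top ∘ₗ hact.lift.toLinearMap)
  have ψ_tmul : ∀ e l, ψ (e ⊗ₜ l) = hact.lift e (top l) := fun _ _ => rfl
  have ψ_smul : ∀ e t, ψ (e • t) = hact.lift e (ψ t) := by
    intro e t
    induction t with
    | zero => simp
    | add t t' h h' => rw [smul_add, map_add, h, h', map_add, map_add]
    | tmul e' l =>
      rw [TensorProduct.smul_tmul', smul_eq_mul, ψ_tmul, ψ_tmul, map_mul, Module.End.mul_apply]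
  have hker : (G.kacRel L y).restrictScalars ℂ ≤ LinearMap.ker ψ := by
    intro t ht
    change t ∈ G.kacRel L y at ht
    rw [LinearMap.mem_ker]
    induction ht using Submodule.span_induction with
    | zero => exact map_zero ψ
    | add a b _ _ ha hb => rw [map_add, ha, hb, add_zero]
    | smul e a _ ha => rw [ψ_smul, ha, map_zero]
    | mem t ht =>
      obtain ⟨x, l, rfl⟩ | ⟨l, rfl⟩ | ⟨u, l, hu, rfl⟩ := ht
      · have hx : G.Even (G.ofSS x) := G.ss_even x x.2
        have := hA.even_top ⟨G.ofSS x, hx⟩ l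
        rw [evenAct_ss] at this
        rw [map_sub, ψ_tmul, ψ_tmul, hact.lift_env, map_one, this]
        exact sub_self _
      · have := (hA.even_top ⟨G.Y, G.Y_even⟩ l).trans
          (congrArg top (G.evenAct_Y L y G.Y_even l))
        rw [map_sub, ψ_tmul, ψ_tmul, hact.lift_env, map_one, this]
        exact sub_self _
      · rw [ψ_tmul, hact.lift_env]
        exact hA.raising_top ⟨u, hu⟩ l
  refine ⟨((G.kacRel L y).restrictScalars ℂ).liftQ ψ hker ∘ₗ
    (Submodule.Quotient.restrictScalarsEquiv ℂ (G.kacRel L y)).symm.toLinearMap,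
    fun l => ?_, fun x k => ?_⟩
  · change ψ (1 ⊗ₜ l) = top l
    rw [ψ_tmul, map_one]
    rfl
  · obtain ⟨t, rfl⟩ := (G.kacRel L y).mkQ_surjective k
    change ψ (G.env x • t) = A x (ψ t)
    rw [ψ_smul, hact.lift_env]

/-- Freeness gives a map equivariant for the lowering elements. The even and then the raising
elements obey the same recursions in `Env` as on `M`, with the same values on `L`, so the map is
equivariant for them too. -/
theorem IsModelAct.exists_toKac (free : IsFree low top) (hA : G.IsModelAct L low top y A) :
    ∃ Ψ : M →ₗ[ℂ] G.Kac L y, (∀ l, Ψ (top l) = G.top L y l) ∧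
      ∀ x m, Ψ (A x m) = G.env x • Ψ m := by
  obtain ⟨Ψ, h1, h2⟩ := free.exists_lift (G.act L y ∘ₗ G.lowering.subtype) (fun v k => by
    change G.env v • G.env v • k = 0
    rw [← mul_smul, env_mul_self (G.isLowering_of_lowering v), zero_smul]) (G.topMap L y)
  have hlow : ∀ v, G.IsLowering v → ∀ m, Ψ (A v m) = G.env v • Ψ m := fun v hv m => by
    have := hA.low_eq ⟨v, hv⟩
    simp only at this
    rw [this, h2]
    rfl
  have heven : ∀ a, G.Even a → ∀ m, Ψ (A a m) = G.env a • Ψ m := fun a ha m => by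
    refine LinearMap.congr_fun (f := Ψ ∘ₗ A a) (g := G.act L y a ∘ₗ Ψ)
      (hA.hom_ext free (fun l => ?_) fun v hv m hm => ?_) m
    · have h3 := hA.even_top ⟨a, ha⟩ l
      simp only at h3
      rw [LinearMap.comp_apply, LinearMap.comp_apply, h3, h1, h1, topMap_apply, topMap_apply,
        act_apply]
      exact (G.even_smul_top L y ⟨a, ha⟩ l).symm
    · rw [LinearMap.comp_apply, LinearMap.comp_apply, act_apply] at hm ⊢
      rw [hA.comm_low ha hv, map_add, hlow v hv, hlow _ (isLowering_comm ha hv), hlow v hv, hm,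
        env_comm, ← mul_smul, ← mul_smul, ← add_smul, sub_add_cancel]
  have hraising : ∀ u, G.IsRaising u → ∀ m, Ψ (A u m) = G.env u • Ψ m := fun u hu m => by
    refine LinearMap.congr_fun (f := Ψ ∘ₗ A u) (g := G.act L y u ∘ₗ Ψ)
      (hA.hom_ext free (fun l => ?_) fun v hv m hm => ?_) m
    · have h3 := hA.raising_top ⟨u, hu⟩ l
      simp only at h3
      rw [LinearMap.comp_apply, LinearMap.comp_apply, h3, h1, map_zero, topMap_apply,
        act_apply, G.raising_smul_top L y hu]
    · rw [LinearMap.comp_apply, LinearMap.comp_apply, act_apply] at hm ⊢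
      rw [hA.anticomm_low hu hv, map_sub, hlow v hv, heven _ (even_anticomm hu.1 hv.1),
        hlow v hv, hm, env_anticomm, ← mul_smul, ← mul_smul, ← sub_smul, add_sub_cancel_right]
  refine ⟨Ψ, h1, fun x => ?_⟩
  refine G.carrier_induction x (fun x z hx hz m => ?_) heven hraising hlow
  rw [map_add, LinearMap.add_apply, map_add, hx, hz, map_add, add_smul]

/-- The Kac module is the free module over `Λ(𝔤₋₁)` generated by `L`. -/
theorem IsModelAct.exists_equiv (free : IsFree low top) (hA : G.IsModelAct L low top y A) :
    ∃ e : M ≃ₗ[ℂ] G.Kac L y, (∀ l, e (top l) = G.top L y l) ∧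
      (∀ x m, e (A x m) = G.act L y x (e m)) ∧
      ∀ c m, e ((hA.isAction free).lift c m) = c • e m := by
  obtain ⟨Φ, hΦ, hΦA⟩ := hA.exists_ofKac free
  obtain ⟨Ψ, hΨ, hΨA⟩ := hA.exists_toKac free
  have hinv : Φ ∘ₗ Ψ = LinearMap.id :=
    hA.hom_ext free (fun l => by simp [hΨ, hΦ]) fun v _ m hm => by
      rw [LinearMap.comp_apply] at hm ⊢
      rw [hΨA, hΦA, hm]
      rfl
  have hlift : ∀ c m, Ψ ((hA.isAction free).lift c m) = c • Ψ m := by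
    intro c
    have hc : c ∈ Algebra.adjoin ℂ (Set.range G.env) := by rw [G.adjoin_env]; trivial
    induction hc using Algebra.adjoin_induction with
    | mem c hc =>
      obtain ⟨x, rfl⟩ := hc
      intro m
      rw [IsAction.lift_env, hΨA]
    | algebraMap r =>
      intro m
      rw [AlgHom.commutes, Module.algebraMap_end_apply, map_smul, algebraMap_smul]
    | add a b _ _ ha hb =>
      intro m
      rw [map_add, LinearMap.add_apply, map_add, ha, hb, add_smul]
    | mul a b _ _ ha hb =>
      intro m
      rw [map_mul, Module.End.mul_apply, ha, hb, mul_smul]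
  -- The class of `c ⊗ l` is `c` applied to the image of `l`, hence the image of `c · top l`.
  have hsurj : LinearMap.range Ψ = ⊤ := by
    rw [eq_top_iff]
    rintro k -
    obtain ⟨t, rfl⟩ := (G.kacRel L y).mkQ_surjective k
    induction t with
    | zero => rw [map_zero]; exact Submodule.zero_mem _
    | add a b ha hb => rw [map_add]; exact Submodule.add_mem _ ha hb
    | tmul c l =>
      refine ⟨(hA.isAction free).lift c (top l), ?_⟩
      rw [hlift, hΨ, HyperSuperalgebra.top, ← map_smul, TensorProduct.smul_tmul', smul_eq_mul,
        mul_one]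
  exact ⟨LinearEquiv.ofBijective Ψ
    ⟨Function.LeftInverse.injective (g := Φ) (LinearMap.congr_fun hinv),
      LinearMap.range_eq_top.1 hsurj⟩, hΨ, hΨA, hlift⟩

/-! ### The dependence on the hypercharge -/

/-- The values on `L` are affine in the parameter. The recursions look quadratic in the action, but
one factor is always a fixed lowering operator, so affine combinations satisfy them again. -/
theorem IsModelAct.affine {A₀ A₁ : G.carrier →ₗ[ℂ] Module.End ℂ M}
    (h0 : G.IsModelAct L low top 0 A₀) (h1 : G.IsModelAct L low top 1 A₁) (y : ℂ) :
    G.IsModelAct L low top y (A₀ + y • (A₁ - A₀)) := by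
  have hlow : ∀ v : G.lowering, (A₀ + y • (A₁ - A₀)) v = low v := fun v => by
    simp [h0.low_eq, h1.low_eq]
  refine ⟨hlow, fun a l => ?_, fun u l => ?_, fun a v m => ?_, fun u v m => ?_⟩
  · simp [h0.even_top, h1.even_top, G.evenAct_affine L y a l]
  · simp [h0.raising_top, h1.raising_top]
  · have k0 := h0.even_low a v m
    have k1 := h1.even_low a v m
    rw [h0.low_eq] at k0
    rw [h1.low_eq] at k1
    rw [hlow]
    simp only [LinearMap.add_apply, LinearMap.smul_apply, LinearMap.sub_apply, k0, k1, map_add,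
      map_smul, map_sub]
    module
  · have k0 := h0.raising_low u v m
    have k1 := h1.raising_low u v m
    rw [h0.low_eq] at k0
    rw [h1.low_eq] at k1
    rw [hlow]
    simp only [LinearMap.add_apply, LinearMap.smul_apply, LinearMap.sub_apply, k0, k1, map_add,
      map_smul, map_sub]
    module

theorem IsModelAct.sub_lowering {y₀ y₁ : ℂ} {A₀ A₁ : G.carrier →ₗ[ℂ] Module.End ℂ M}
    (h0 : G.IsModelAct L low top y₀ A₀) (h1 : G.IsModelAct L low top y₁ A₁) {v : G.carrier}
    (hv : G.IsLowering v) : (A₁ - A₀) v = 0 :=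
  sub_eq_zero.2 ((h1.low_eq ⟨v, hv⟩).trans (h0.low_eq ⟨v, hv⟩).symm)

/-- True on `L`. The terms in `[a, v]` cancel in the difference of the two recursions, so the
difference commutes with the lowering operators and stays scalar. -/
theorem IsModelAct.sub_even (free : IsFree low top) {y₀ y₁ : ℂ}
    {A₀ A₁ : G.carrier →ₗ[ℂ] Module.End ℂ M}
    (h0 : G.IsModelAct L low top y₀ A₀) (h1 : G.IsModelAct L low top y₁ A₁) (a : G.evenSub) :
    (A₁ - A₀) a = ((y₁ - y₀) * G.charge (a : G.carrier)) • 1 := by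
  refine free.hom_ext (fun l => ?_) fun v m hm => ?_
  · rw [LinearMap.sub_apply, LinearMap.sub_apply, h0.even_top, h1.even_top, evenAct_apply,
      evenAct_apply, ← map_sub, LinearMap.smul_apply, Module.End.one_apply, ← map_smul]
    congr 1
    module
  · have k0 := h0.even_low a v m
    have k1 := h1.even_low a v m
    have e := h1.sub_lowering (h0 := h0) (isLowering_comm (G.even_of_evenSub a)
      (G.isLowering_of_lowering v))
    rw [LinearMap.sub_apply, sub_eq_zero] at e
    rw [h0.low_eq] at k0
    rw [h1.low_eq, e] at k1
    rw [LinearMap.sub_apply, LinearMap.sub_apply] at hm ⊢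
    rw [k0, k1, add_sub_add_left_eq_sub, ← map_sub, hm]
    simp

end kac

end HyperSuperalgebra

open scoped Kronecker

/-! ### Nested block matrices -/

section nest

variable {N D : ℕ}

/-- The matrix with the entries `lam` above the diagonal. -/
def shiftMatrix (lam : Fin (N - 1) → ℂ) : Matrix (Fin N) (Fin N) ℂ :=
  Matrix.of fun i j => if h : i.val + 1 = j.val then lam ⟨i.val, by have := j.isLt; omega⟩ else 0

/-- The form in which nesting is the substitution of a matrix for the increment of the parameter. -/
theorem nest_eq_kronecker (lam : Fin (N - 1) → ℂ) (A B : Matrix (Fin D) (Fin D) ℂ) :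
    nest lam A B = (1 : Matrix (Fin N) (Fin N) ℂ) ⊗ₖ A + shiftMatrix lam ⊗ₖ B := by
  ext ⟨i, a⟩ ⟨j, b⟩
  simp only [nest, shiftMatrix, Matrix.of_apply, Matrix.add_apply, Matrix.kroneckerMap_apply,
    Matrix.one_apply]
  by_cases h : i = j
  · subst h
    simp
  · by_cases h' : i.val + 1 = j.val <;> simp [h, h']

/-- The second-order term need not vanish in a single product; it cancels only in brackets. -/
theorem nest_mul_nest (lam : Fin (N - 1) → ℂ) (A B A' B' : Matrix (Fin D) (Fin D) ℂ) :
    nest lam A B * nest lam A' B' = nest lam (A * A') (A * B' + B * A')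
      + (shiftMatrix lam * shiftMatrix lam) ⊗ₖ (B * B') := by
  simp only [nest_eq_kronecker, add_mul, mul_add, ← Matrix.mul_kronecker_mul, one_mul, mul_one,
    Matrix.kronecker_add]
  abel

theorem nest_add (lam : Fin (N - 1) → ℂ) (A B A' B' : Matrix (Fin D) (Fin D) ℂ) :
    nest lam (A + A') (B + B') = nest lam A B + nest lam A' B' := by
  simp only [nest_eq_kronecker, Matrix.kronecker_add]
  abel

theorem nest_sub (lam : Fin (N - 1) → ℂ) (A B A' B' : Matrix (Fin D) (Fin D) ℂ) :
    nest lam (A - A') (B - B') = nest lam A B - nest lam A' B' := by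
  rw [eq_sub_iff_add_eq, ← nest_add, sub_add_cancel, sub_add_cancel]

theorem nest_mulVec (lam : Fin (N - 1) → ℂ) (A B : Matrix (Fin D) (Fin D) ℂ)
    (w : Fin N × Fin D → ℂ) (k : Fin N) (i : Fin D) :
    (nest lam A B).mulVec w (k, i) = A.mulVec (fun j => w (k, j)) i +
      if h : k.val + 1 < N then
        lam ⟨k.val, by omega⟩ * B.mulVec (fun j => w (⟨k.val + 1, h⟩, j)) i else 0 := by
  rw [nest_eq_kronecker, Matrix.add_mulVec, Pi.add_apply]
  congr 1
  · simp only [Matrix.mulVec, dotProduct, Fintype.sum_prod_type, Matrix.kroneckerMap_apply,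
      Matrix.one_apply, ite_mul, one_mul, zero_mul]
    rw [Finset.sum_eq_single k]
    · simp
    · intro l _ hl
      simp [hl.symm]
    · simp
  · simp only [Matrix.mulVec, dotProduct, Fintype.sum_prod_type, Matrix.kroneckerMap_apply,
      shiftMatrix, Matrix.of_apply]
    split_ifs with h
    · rw [Finset.sum_eq_single ⟨k.val + 1, h⟩]
      · simp [Finset.mul_sum, mul_assoc]
      · intro l _ hl
        have : ¬ k.val + 1 = l.val := fun e => hl (Fin.ext e.symm)
        simp [this]
      · simp
    · refine Finset.sum_eq_zero fun l _ => ?_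
      have : ¬ k.val + 1 = l.val := fun e => h (e ▸ l.isLt)
      simp [this]

/-- Rescaling of the parameters by a block diagonal matrix. -/
theorem exists_rescaling (lam lam' : Fin (N - 1) → ℂ) (h : ∀ i, lam i ≠ 0)
    (h' : ∀ i, lam' i ≠ 0) : ∃ s : Fin N → ℂ, (∀ i, s i ≠ 0) ∧
      ∀ A B : Matrix (Fin D) (Fin D) ℂ,
        Matrix.diagonal (fun q : Fin N × Fin D => s q.1) * nest lam A B *
          Matrix.diagonal (fun q : Fin N × Fin D => (s q.1)⁻¹) = nest lam' A B := by
  -- Conjugation multiplies `lam i` by `s i / s (i + 1)`, which forces the ratio `s (i + 1) / s i =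
  -- lam i / lam' i`. The default `1` keeps all partial products nonzero.
  let r : ℕ → ℂ := fun j => if hj : j < N - 1 then lam ⟨j, hj⟩ / lam' ⟨j, hj⟩ else 1
  have hr : ∀ j, r j ≠ 0 := fun j => by
    by_cases hj : j < N - 1
    · simp [r, hj, h, h']
    · simp [r, hj]
  have hs : ∀ n, ∏ j ∈ Finset.range n, r j ≠ 0 := fun n =>
    Finset.prod_ne_zero_iff.2 fun j _ => hr j
  refine ⟨fun i => ∏ j ∈ Finset.range i, r j, fun i => hs i, fun A B => ?_⟩
  ext ⟨i, a⟩ ⟨j, b⟩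
  rw [Matrix.mul_diagonal, Matrix.diagonal_mul]
  simp only [nest, Matrix.of_apply]
  by_cases hij : i = j
  · subst hij
    simp only [if_true]
    rw [mul_right_comm, mul_inv_cancel₀ (hs i), one_mul]
  · by_cases hij' : i.val + 1 = j.val
    · simp only [hij, hij', if_false, dif_pos]
      have hlt : i.val < N - 1 := by have := j.isLt; omega
      have e : r i = lam ⟨i, hlt⟩ / lam' ⟨i, hlt⟩ := by simp [r, hlt]
      have e' : ∏ m ∈ Finset.range j, r m
          = (∏ m ∈ Finset.range i, r m) * (lam ⟨i, hlt⟩ / lam' ⟨i, hlt⟩) := by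
        rw [← hij', Finset.prod_range_succ, e]
      rw [e']
      have h1 := h ⟨i, hlt⟩
      have h2 := h' ⟨i, hlt⟩
      have h3 := hs i
      field_simp
    · simp [hij, hij']

end nest

namespace HyperSuperalgebra

variable {G : HyperSuperalgebra}

/-! ### Parity of the matrices and the nested representation -/

section rep

variable {D : ℕ} {A B : G.carrier →ₗ[ℂ] Matrix (Fin D) (Fin D) ℂ} {p : Fin D → ℕ}

theorem comm_Y_even {x : G.carrier} (hx : G.Even x) : G.comm G.Y x G.Y_even = 0 :=
  Subtype.ext (sub_eq_zero.2 (G.Y_comm x x.2 hx))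

/-- The entry at `(i, j)` of `[Y, x] = s x` reads `(p j - p i) * A x i j = s * A x i j`. -/
theorem apply_eq_zero_of_comm {x : G.carrier} {y s : ℂ} (hA : IsAction A)
    (hY : A G.Y = Matrix.diagonal fun j => y - p j) (hx : G.comm G.Y x G.Y_even = s • x)
    {i j : Fin D} (hij : (p j : ℂ) ≠ p i + s) : A x i j = 0 := by
  have h := hA.comm G.Y x G.Y_even
  rw [hx, map_smul, hY] at h
  have h' := congrFun (congrFun h i) j
  rw [Matrix.sub_apply, Matrix.diagonal_mul, Matrix.mul_diagonal, Matrix.smul_apply,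
    smul_eq_mul] at h'
  have : (p j - (p i + s)) * A x i j = 0 := by linear_combination -h'
  exact (mul_eq_zero.1 this).resolve_left (sub_ne_zero.2 hij)

theorem isEven_of_isAction {x : G.carrier} {y : ℂ} (hA : IsAction A)
    (hY : A G.Y = Matrix.diagonal fun j => y - p j) (hx : G.Even x) :
    IsEven (fun j => (p j : ZMod 2)) (A x) := fun i j hij =>
  apply_eq_zero_of_comm (s := 0) hA hY (by rw [comm_Y_even hx, zero_smul]) fun e => hij (by
    rw [add_zero] at e
    exact congrArg Nat.cast (Nat.cast_injective e).symm)

/-- Raising and lowering components change `p` by exactly one, which flips its parity. -/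
theorem isOdd_of_isAction {x : G.carrier} {y : ℂ} (hA : IsAction A)
    (hY : A G.Y = Matrix.diagonal fun j => y - p j) (hx : G.Odd x) :
    IsOdd (fun j => (p j : ZMod 2)) (A x) := by
  refine odd_induction (P := fun x => IsOdd (fun j => (p j : ZMod 2)) (A x)) hx
    fun u v hu hv i j hij => ?_
  have hij : (p i : ZMod 2) = p j := hij
  rw [map_add, Matrix.add_apply,
    apply_eq_zero_of_comm (s := 1) hA hY ((G.commY_raising hu).trans (one_smul ℂ u).symm),
    apply_eq_zero_of_comm (s := -1) hA hY ((G.commY_lowering hv).trans (neg_one_smul ℂ v).symm),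
    add_zero]
  · intro e
    have e' : p i = p j + 1 := by
      have : (p i : ℂ) = p j + 1 := by linear_combination -e
      exact_mod_cast this
    rw [e', Nat.cast_add, Nat.cast_one] at hij
    simp at hij
  · intro e
    have e' : p j = p i + 1 := by exact_mod_cast e
    rw [e', Nat.cast_add, Nat.cast_one] at hij
    simp at hij

/-- The nested matrices represent the superalgebra. -/
theorem isRep_nestMap (h : ∀ z : ℂ, IsAction (A + z • B))
    (hY : ∀ z : ℂ, (A + z • B) G.Y = Matrix.diagonal fun j => z - p j) (y : ℂ) {N : ℕ}
    (lam : Fin (N - 1) → ℂ) :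
    G.IsRep (fun q : Fin N × Fin D => (p q.2 : ZMod 2)) (nestMap lam (A + y • B) B) := by
  -- As a difference of two members of the family, the slope inherits their parity.
  have hB : B = (A + (1 : ℂ) • B) - (A + (0 : ℂ) • B) := by simp
  have shift : ∀ z : ℂ, IsAction ((A + y • B) + z • B) := fun z => by
    rw [add_assoc, ← add_smul]
    exact h (y + z)
  refine ⟨fun x hx => ?_, fun x hx => ?_, fun x z hx => ?_, fun x z hx hz => ?_⟩
  · have hA' := isEven_of_isAction (h y) (hY y) hx
    have hB' : IsEven (fun j => (p j : ZMod 2)) (B x) := by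
      rw [hB]
      exact (isEven_of_isAction (h 1) (hY 1) hx).sub (isEven_of_isAction (h 0) (hY 0) hx)
    rintro ⟨k, i⟩ ⟨l, j⟩ hij
    change nest lam _ _ _ _ = 0
    simp only [nest, Matrix.of_apply, hA' i j hij, hB' i j hij, mul_zero, dite_eq_ite, ite_self]
  · have hA' := isOdd_of_isAction (h y) (hY y) hx
    have hB' : IsOdd (fun j => (p j : ZMod 2)) (B x) := by
      rw [hB]
      exact (isOdd_of_isAction (h 1) (hY 1) hx).sub (isOdd_of_isAction (h 0) (hY 0) hx)
    rintro ⟨k, i⟩ ⟨l, j⟩ hij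
    change nest lam _ _ _ _ = 0
    simp only [nest, Matrix.of_apply, hA' i j hij, hB' i j hij, mul_zero, dite_eq_ite, ite_self]
  -- The quadratic coefficient `h2` removes the second-order term of `nest_mul_nest`; the Leibniz
  -- rule `h1` matches the blocks above the diagonal.
  · obtain ⟨h2, h1⟩ := IsAction.comm_coeff shift x z hx
    change nest lam _ _ = nest lam _ _ * nest lam _ _ - nest lam _ _ * nest lam _ _
    rw [nest_mul_nest, nest_mul_nest, sub_eq_zero.1 h2, (h y).comm, h1, add_sub_add_right_eq_sub,
      ← nest_sub]
    congr 1
    abel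
  · obtain ⟨h2, h1⟩ := IsAction.anticomm_coeff shift x z hx hz
    change nest lam _ _ = nest lam _ _ * nest lam _ _ + nest lam _ _ * nest lam _ _
    rw [nest_mul_nest, nest_mul_nest, eq_neg_of_add_eq_zero_left h2, (h y).anticomm, h1,
      add_add_add_comm, ← nest_add, ← Matrix.kronecker_add, neg_add_cancel, Matrix.kronecker_zero,
      add_zero]
    congr 1
    abel

end rep

end HyperSuperalgebra

/-! ### The filtration -/

section flag

variable {K : Type*} [AddCommGroup K] [Module ℂ K] {N D : ℕ}

/-- The map `π` reads block `k` (counted from zero) in the basis `b`. On the first `k + 1` blocks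
the next block is zero, so the term above the diagonal does not reach block `k`. -/
theorem exists_flag_quotient (b : Module.Basis (Fin D) ℂ K) (k : Fin N) :
    ∃ π : (Fin N × Fin D → ℂ) →ₗ[ℂ] K,
      (flag N D (k + 1)).map π = ⊤ ∧
      flag N D (k + 1) ⊓ LinearMap.ker π = flag N D k ∧
      ∀ (lam : Fin (N - 1) → ℂ) (f : Module.End ℂ K) (B : Matrix (Fin D) (Fin D) ℂ),
        ∀ w ∈ flag N D (k + 1),
          (nest lam (LinearMap.toMatrix b b f) B).mulVec w ∈ flag N D (k + 1) ∧
          π ((nest lam (LinearMap.toMatrix b b f) B).mulVec w) = f (π w) := by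
  let π : (Fin N × Fin D → ℂ) →ₗ[ℂ] K :=
    b.equivFun.symm.toLinearMap ∘ₗ LinearMap.funLeft ℂ ℂ fun j => (k, j)
  have hπ : ∀ w, π w = b.equivFun.symm fun j => w (k, j) := fun _ => rfl
  refine ⟨π, ?_, ?_, fun lam f B w hw => ⟨?_, ?_⟩⟩
  · rw [eq_top_iff]
    rintro m -
    refine ⟨fun q => if q.1 = k then b.equivFun m q.2 else 0, fun q hq => ?_, ?_⟩
    · have : q.1 ≠ k := fun e => by rw [e] at hq; omega
      simp [this]
    · rw [hπ]
      simp
  · ext w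
    rw [Submodule.mem_inf, LinearMap.mem_ker, hπ, LinearEquiv.map_eq_zero_iff]
    constructor
    · rintro ⟨h1, h2⟩ ⟨i, j⟩ hi
      by_cases e : i = k
      · rw [e]
        exact congrFun h2 j
      · have : i.val ≠ k.val := fun e' => e (Fin.ext e')
        exact h1 _ (by simp only at hi ⊢; omega)
    · exact fun h => ⟨fun q hq => h q (by omega), funext fun j => h (k, j) le_rfl⟩
  · rintro ⟨i, a⟩ hi
    simp only at hi
    have e1 : (fun j => w (i, j)) = 0 := funext fun j => hw (i, j) hi
    rw [nest_mulVec, e1, Matrix.mulVec_zero]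
    split_ifs with h
    · have e2 : (fun j => w (⟨i.val + 1, h⟩, j)) = 0 :=
        funext fun j => hw (⟨i.val + 1, h⟩, j) (by simp only; omega)
      simp [e2]
    · simp
  · rw [hπ, hπ]
    have e : (fun j => (nest lam (LinearMap.toMatrix b b f) B).mulVec w (k, j))
        = (LinearMap.toMatrix b b f).mulVec fun j => w (k, j) := by
      funext j
      rw [nest_mulVec]
      split_ifs with h
      · have e2 : (fun j => w (⟨k.val + 1, h⟩, j)) = 0 :=
          funext fun j => hw (⟨k.val + 1, h⟩, j) le_rfl
        simp [e2]
      · simp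
    rw [e, LinearEquiv.symm_apply_eq]
    have := LinearMap.toMatrix_mulVec_repr b b f (b.equivFun.symm fun j => w (k, j))
    rw [← Module.Basis.equivFun_apply, LinearEquiv.apply_symm_apply] at this
    rw [this]
    rfl

end flag

namespace HyperSuperalgebra

variable {G : HyperSuperalgebra}

/-- The shift of a tuple by one place, with coefficients `lam`. -/
def shift {M : Type*} [AddCommGroup M] [Module ℂ M] {N : ℕ} (lam : Fin (N - 1) → ℂ)
    (f : Fin N → M) (k : Fin N) : M :=
  if h : k.val + 1 < N then lam ⟨k.val, by omega⟩ • f ⟨k.val + 1, h⟩ else 0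

/-! ### Submodules of nested copies of an irreducible module -/

section irreducible

variable {L : Type*} [AddCommGroup L] [Module ℂ L] [LieRingModule G.ss L]
  [LieModule.IsIrreducible ℂ G.ss L]

theorem eq_top_of_lie_mem (S : Submodule ℂ L) (hS : ∀ (x : G.ss), ∀ l ∈ S, ⁅x, l⁆ ∈ S) {l₀ : L}
    (h₀ : l₀ ∈ S) (hne : l₀ ≠ 0) : S = ⊤ := by
  let N : LieSubmodule ℂ G.ss L := { S with lie_mem := fun {x l} hl => hS x l hl }
  have hN : N = ⊤ := (IsSimpleOrder.eq_bot_or_eq_top N).resolve_left fun h => hne (by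
    have : l₀ ∈ N := h₀
    rwa [h, LieSubmodule.mem_bot] at this)
  rw [eq_top_iff]
  intro l _
  have : l ∈ N := hN ▸ LieSubmodule.mem_top l
  exact this

/-- By irreducibility the last coordinates of `P` fill `L`. Each shift moves them one place back and
leaves zeros behind, so any vector of `L` occurs as a leading coefficient at any place; triangular
elimination finishes. -/
theorem eq_top_of_shift_mem {N : ℕ} {lam : Fin (N - 1) → ℂ} (hlam : ∀ i, lam i ≠ 0)
    (P : Submodule ℂ (Fin N → L)) (hss : ∀ (x : G.ss), ∀ f ∈ P, (fun k => ⁅x, f k⁆) ∈ P)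
    (hshift : ∀ f ∈ P, shift lam f ∈ P) {last : Fin N} (hlast : last.val + 1 = N)
    {f₀ : Fin N → L} (hf₀ : f₀ ∈ P) (hne : f₀ last ≠ 0) : P = ⊤ := by
  -- every vector of `L` is the leading coefficient at the place `N - 1 - d`
  have lead : ∀ d : ℕ, ∀ k : Fin N, k.val + d + 1 = N → ∀ l : L,
      ∃ f ∈ P, f k = l ∧ ∀ i : Fin N, k < i → f i = 0 := by
    intro d
    induction d with
    | zero =>
      intro k hk l
      have hk' : k = last := Fin.ext (by omega)
      have hi : ∀ i : Fin N, ¬ k < i := fun i hi => by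
        have := i.isLt
        have : k.val < i.val := hi
        omega
      have htop : P.map (LinearMap.proj last) = ⊤ := by
        refine eq_top_of_lie_mem (G := G) _ ?_ ⟨f₀, hf₀, rfl⟩ hne
        rintro x _ ⟨f, hf, rfl⟩
        exact ⟨_, hss x f hf, rfl⟩
      obtain ⟨f, hf, h⟩ : l ∈ P.map (LinearMap.proj last) := htop ▸ Submodule.mem_top
      exact ⟨f, hf, hk' ▸ h, fun i h => absurd h (hi i)⟩
    | succ d ih =>
      intro k hk l
      have hk1 : k.val + 1 < N := by omega
      obtain ⟨f, hf, h1, h2⟩ := ih ⟨k.val + 1, hk1⟩ (by simp only; omega)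
        ((lam ⟨k.val, by omega⟩)⁻¹ • l)
      refine ⟨_, hshift f hf, ?_, fun i hi => ?_⟩
      · rw [shift, dif_pos hk1, h1, smul_inv_smul₀ (hlam _)]
      · rw [shift]
        split_ifs with h
        · rw [h2 ⟨i.val + 1, h⟩ (by
            have : k.val < i.val := hi
            exact Fin.mk_lt_mk.2 (by omega)), smul_zero]
        · rfl
  -- Elimination on the length of the support: subtract an element of `P` with the same leading
  -- coefficient.
  have key : ∀ n : ℕ, ∀ f : Fin N → L, (∀ k : Fin N, n ≤ k.val → f k = 0) → f ∈ P := by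
    intro n
    induction n with
    | zero =>
      intro f hf
      have : f = 0 := funext fun k => hf k (Nat.zero_le _)
      exact this ▸ P.zero_mem
    | succ n ih =>
      intro f hf
      by_cases hn : n < N
      · obtain ⟨g, hg, h1, h2⟩ := lead (N - 1 - n) ⟨n, hn⟩ (by simp only; omega) (f ⟨n, hn⟩)
        rw [← sub_add_cancel f g]
        refine P.add_mem (ih _ fun k hk => ?_) hg
        rcases hk.eq_or_lt with e | e
        · have : k = ⟨n, hn⟩ := Fin.ext e.symm
          rw [Pi.sub_apply, this, h1, sub_self]
        · rw [Pi.sub_apply, hf k e, h2 k (Fin.lt_def.2 e), sub_self]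
      · exact ih f fun k hk => absurd k.isLt (by omega)
  rw [eq_top_iff]
  exact fun f _ => key N f fun k hk => absurd k.isLt (by omega)

end irreducible

theorem isAction_toMatrix {M : Type*} [AddCommGroup M] [Module ℂ M] {D : ℕ}
    (β : Module.Basis (Fin D) ℂ M) {A : G.carrier →ₗ[ℂ] Module.End ℂ M} (hA : IsAction A) :
    IsAction ((LinearMap.toMatrix β β).toLinearMap ∘ₗ A) :=
  ⟨fun x z hx => by simp [hA.comm, LinearMap.toMatrix_mul],
    fun x z hx hz => by simp [hA.anticomm, LinearMap.toMatrix_mul]⟩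

/-! ### Homogeneous bases -/

section model

variable {L : Type u} [AddCommGroup L] [Module ℂ L] [LieRingModule G.ss L] [LieModule ℂ G.ss L]
  {M : Type u} [AddCommGroup M] [Module ℂ M]
  {low : G.lowering →ₗ[ℂ] Module.End ℂ M} {top : L →ₗ[ℂ] M}
  {y : ℂ} {A : G.carrier →ₗ[ℂ] Module.End ℂ M}

theorem ss_eq (free : IsFree low top) (hA : G.IsModelAct L low top y A) {y' : ℂ}
    {A' : G.carrier →ₗ[ℂ] Module.End ℂ M} (hA' : G.IsModelAct L low top y' A') (x : G.ss) :
    A (G.ofSS x) = A' (G.ofSS x) := by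
  have := hA'.sub_even free hA ⟨G.ofSS x, G.ss_even x x.2⟩
  have h0 : G.charge (G.ofSS x) = 0 := G.charge_ss x.2
  rw [h0, mul_zero, zero_smul] at this
  exact sub_eq_zero.1 this

theorem ss_top (hA : G.IsModelAct L low top y A) (x : G.ss) (l : L) :
    A (G.ofSS x) (top l) = top ⁅x, l⁆ :=
  (hA.even_top ⟨G.ofSS x, G.ss_even x x.2⟩ l).trans (congrArg top (G.evenAct_ss L y x _ l))

theorem Y_top (hA : G.IsModelAct L low top y A) (l : L) : A G.Y (top l) = y • top l :=
  ((hA.even_top ⟨G.Y, G.Y_even⟩ l).trans (congrArg top (G.evenAct_Y L y G.Y_even l))).trans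
    (top.map_smul y l)

/-- The generators, semisimple and lowering, act by operators that do not involve the parameter.
This is why one choice of `c_j` serves all `y`. -/
theorem lift_lowerEnv (free : IsFree low top) (hA : G.IsModelAct L low top y A) {y' : ℂ}
    {A' : G.carrier →ₗ[ℂ] Module.End ℂ M} (hA' : G.IsModelAct L low top y' A') {c : G.Env}
    (hc : c ∈ G.lowerEnv) : (hA.isAction free).lift c = (hA'.isAction free).lift c := by
  induction hc using Algebra.adjoin_induction with
  | mem c hc =>
    obtain ⟨x, rfl⟩ | ⟨v, hv, rfl⟩ := hc
    · rw [IsAction.lift_env, IsAction.lift_env, ss_eq free hA hA']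
    · rw [IsAction.lift_env, IsAction.lift_env]
      exact (hA.low_eq ⟨v, hv⟩).trans (hA'.low_eq ⟨v, hv⟩).symm
  | algebraMap r => rw [AlgHom.commutes, AlgHom.commutes]
  | add a b _ _ ha hb => rw [map_add, map_add, ha, hb]
  | mul a b _ _ ha hb => rw [map_mul, map_mul, ha, hb]

variable (G) in
/-- The homogeneous elements of the algebra generated by `𝔤_ss` and `𝔤₋₁`. -/
def IsHomogeneous (c : G.Env) : Prop :=
  c ∈ G.lowerEnv ∧ ∃ p : ℕ, G.env G.Y * c - c * G.env G.Y = -(p : ℂ) • c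

theorem IsHomogeneous.ss_mul {c : G.Env} (hc : G.IsHomogeneous c) (x : G.ss) :
    G.IsHomogeneous (G.env (G.ofSS x) * c) := by
  obtain ⟨h, p, hp⟩ := hc
  refine ⟨mul_mem (Algebra.subset_adjoin (Or.inl ⟨x, rfl⟩)) h, p, ?_⟩
  have e := env_comm G.Y (G.ofSS x) G.Y_even
  rw [comm_Y_even (x := G.ofSS x) (G.ss_even x x.2), map_zero] at e
  rw [← mul_smul_comm, ← hp]
  linear_combination (norm := noncomm_ring) -e * c

theorem IsHomogeneous.low_mul {c : G.Env} (hc : G.IsHomogeneous c) {v : G.carrier}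
    (hv : G.IsLowering v) : G.IsHomogeneous (G.env v * c) := by
  obtain ⟨h, p, hp⟩ := hc
  refine ⟨mul_mem (Algebra.subset_adjoin (Or.inr ⟨v, hv, rfl⟩)) h, p + 1, ?_⟩
  have e := env_comm G.Y v G.Y_even
  rw [show G.comm G.Y v G.Y_even = -v from G.commY_lowering hv, map_neg] at e
  have e2 : -((p + 1 : ℕ) : ℂ) • (G.env v * c) = G.env v * (-(p : ℂ) • c) - G.env v * c := by
    rw [mul_smul_comm]
    push_cast
    module
  rw [e2, ← hp]
  linear_combination (norm := noncomm_ring) -e * c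

variable [LieModule.IsIrreducible ℂ G.ss L]

/-- Homogeneity survives left multiplication by semisimple and by lowering elements. So the span
meets `L` in a submodule containing `Λ`, hence contains `L`, and freeness does the rest. -/
theorem span_homogeneous (free : IsFree low top) (hA : G.IsModelAct L low top y A) {Λ : L}
    (hΛ : Λ ≠ 0) : Submodule.span ℂ {m | ∃ c, G.IsHomogeneous c ∧
      m = (hA.isAction free).lift c (top Λ)} = ⊤ := by
  set S := Submodule.span ℂ {m | ∃ c, G.IsHomogeneous c ∧
      m = (hA.isAction free).lift c (top Λ)} with hS
  have stable : ∀ x : G.carrier, (∀ c, G.IsHomogeneous c → G.IsHomogeneous (G.env x * c)) →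
      ∀ m ∈ S, A x m ∈ S := by
    intro x hx m hm
    rw [hS] at hm
    induction hm using Submodule.span_induction with
    | zero => rw [map_zero]; exact S.zero_mem
    | add a b _ _ ha hb => rw [map_add]; exact S.add_mem ha hb
    | smul r a _ ha => rw [map_smul]; exact S.smul_mem r ha
    | mem m hm =>
      obtain ⟨c, hc, rfl⟩ := hm
      refine Submodule.subset_span ⟨_, hx c hc, ?_⟩
      rw [map_mul, Module.End.mul_apply, IsAction.lift_env]
  have hL : S.comap top = ⊤ := by
    refine eq_top_of_lie_mem (G := G) _ (fun x l hl => ?_) (l₀ := Λ) ?_ hΛ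
    · rw [Submodule.mem_comap, ← ss_top hA]
      exact stable _ (fun c hc => hc.ss_mul x) _ hl
    · refine Submodule.subset_span ⟨1, ⟨one_mem _, 0, by simp⟩, ?_⟩
      rw [map_one]
      rfl
  refine free.eq_top S (fun l => ?_) fun v m hm => ?_
  · have : l ∈ S.comap top := hL ▸ Submodule.mem_top
    exact this
  · rw [← hA.low_eq]
    exact stable _ (fun c hc => hc.low_mul (G.isLowering_of_lowering v)) _ hm

/-- A basis of `M` is extracted from the homogeneous spanning set at the parameter `0` and carried
to each Kac module. By `lift_lowerEnv` its vectors are `c_j Λ` for every `y`. -/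
theorem exists_homogeneous_basis [FiniteDimensional ℂ M] (free : IsFree low top)
    {A : ℂ → G.carrier →ₗ[ℂ] Module.End ℂ M} (hA : ∀ y, G.IsModelAct L low top y (A y)) {Λ : L}
    (hΛ : Λ ≠ 0) : ∃ (D : ℕ) (c : Fin D → G.Env) (p : Fin D → ℕ)
      (b : (y : ℂ) → Module.Basis (Fin D) ℂ (G.Kac L y)),
      (∀ j, c j ∈ G.lowerEnv) ∧
      (∀ j, G.env G.Y * c j - c j * G.env G.Y = -(p j : ℂ) • c j) ∧
      ∀ y j, b y j = c j • G.top L y Λ := by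
  obtain ⟨s, hs, hspan, hli⟩ := exists_linearIndependent ℂ
    {m | ∃ c, G.IsHomogeneous c ∧ m = ((hA 0).isAction free).lift c (top Λ)}
  rw [span_homogeneous free (hA 0) hΛ] at hspan
  let β := Module.Basis.mk hli (by rw [Subtype.range_coe, hspan])
  have : Fintype s := FiniteDimensional.fintypeBasisIndex β
  choose c hc hcβ using fun m : s => hs m.2
  choose hcl p hp using hc
  choose e he1 he2 he3 using fun y => (hA y).exists_equiv free
  let φ := Fintype.equivFin s
  refine ⟨Fintype.card s, fun j => c (φ.symm j), fun j => p (φ.symm j),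
    fun y => (β.reindex φ).map (e y), fun j => hcl _, fun j => hp _, fun y j => ?_⟩
  rw [Module.Basis.map_apply, Module.Basis.reindex_apply, Module.Basis.mk_apply, hcβ,
    lift_lowerEnv free (hA 0) (hA y) (hcl _), he3, he1]

end model

/-! ### The matrices of the Kac modules -/

section matrices

variable {L : Type u} [AddCommGroup L] [Module ℂ L] [LieRingModule G.ss L]
  {M : Type u} [AddCommGroup M] [Module ℂ M]
  {low : G.lowering →ₗ[ℂ] Module.End ℂ M} {top : L →ₗ[ℂ] M}

/-- Moving `Y` past `c j` costs `-p j`, and `Y` acts on `Λ` by `y`. -/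
theorem kacMatrix_Y {Λ : L} {D : ℕ} {c : Fin D → G.Env} {p : Fin D → ℕ} {y : ℂ}
    {b : Module.Basis (Fin D) ℂ (G.Kac L y)}
    (hp : ∀ j, G.env G.Y * c j - c j * G.env G.Y = -(p j : ℂ) • c j)
    (hb : ∀ j, b j = c j • G.top L y Λ) :
    G.kacMatrix L y b G.Y = Matrix.diagonal fun j => y - p j := by
  have h : ∀ j, G.act L y G.Y (b j) = (y - p j) • b j := fun j => by
    have e := sub_eq_iff_eq_add.1 (hp j)
    rw [act_apply, hb, ← mul_smul, e, add_smul, mul_smul, Y_smul_top, smul_assoc,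
      smul_algebra_smul_comm, sub_smul, neg_smul]
    abel
  ext i j
  change LinearMap.toMatrix b b (G.act L y G.Y) i j = _
  rw [LinearMap.toMatrix_apply, h, map_smul, Module.Basis.repr_self, Finsupp.smul_apply,
    Finsupp.single_apply, Matrix.diagonal_apply]
  by_cases hij : i = j
  · simp [hij]
  · simp [hij, Ne.symm hij]

variable [LieModule ℂ G.ss L]

/-- Pulled back to `M`, the given bases all coincide, again by `lift_lowerEnv`; the Kac matrices
thus inherit the affine dependence on `y`. -/
theorem exists_common_basis (free : IsFree low top)
    {A : ℂ → G.carrier →ₗ[ℂ] Module.End ℂ M} (hA : ∀ y, G.IsModelAct L low top y (A y)) {Λ : L}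
    {D : ℕ} {c : Fin D → G.Env} {b : (y : ℂ) → Module.Basis (Fin D) ℂ (G.Kac L y)}
    (hc : ∀ j, c j ∈ G.lowerEnv) (hb : ∀ y j, b y j = c j • G.top L y Λ) :
    ∃ β : Module.Basis (Fin D) ℂ M, ∀ y x,
      G.kacMatrix L y (b y) x = LinearMap.toMatrix β β (A y x) := by
  choose e he1 he2 he3 using fun y => (hA y).exists_equiv free
  have hβ : ∀ y j, ((b 0).map (e 0).symm).map (e y) j = b y j := fun y j => by
    rw [Module.Basis.map_apply, Module.Basis.map_apply, hb, hb, ← he1 0, ← he3 0,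
      LinearEquiv.symm_apply_apply, lift_lowerEnv free (hA 0) (hA y) (hc j), he3, he1]
  refine ⟨(b 0).map (e 0).symm, fun y x => ?_⟩
  rw [← Module.Basis.eq_of_apply_eq (hβ y)]
  ext i j
  change LinearMap.toMatrix _ _ (G.act L y x) i j = _
  rw [LinearMap.toMatrix_apply, LinearMap.toMatrix_apply, Module.Basis.map_apply (_) (e y), ← he2,
    Module.Basis.map_repr, LinearEquiv.trans_apply, LinearEquiv.symm_apply_apply]

end matrices

end HyperSuperalgebra

namespace HyperSuperalgebra

variable {G : HyperSuperalgebra}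

/-! ### Indecomposability -/

section indecomposable

variable {L : Type u} [AddCommGroup L] [Module ℂ L] [LieRingModule G.ss L] [LieModule ℂ G.ss L]
  {M : Type u} [AddCommGroup M] [Module ℂ M]
  {low : G.lowering →ₗ[ℂ] Module.End ℂ M} {top : L →ₗ[ℂ] M}
  {y : ℂ} {A : G.carrier →ₗ[ℂ] Module.End ℂ M} {D : ℕ} {β : Module.Basis (Fin D) ℂ M}
  {p : Fin D → ℕ}

theorem repr_Y (hY : LinearMap.toMatrix β β (A G.Y) = Matrix.diagonal fun j => y - p j) (m : M)
    (j : Fin D) : β.repr (A G.Y m) j = (y - p j) * β.repr m j := by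
  rw [← LinearMap.toMatrix_mulVec_repr β β, hY, Matrix.mulVec_diagonal]

/-- A contribution at `p i = 0` could only come from an index with `p j = -1`. -/
theorem repr_lowering (hA : IsAction A)
    (hY : LinearMap.toMatrix β β (A G.Y) = Matrix.diagonal fun j => y - p j) {v : G.carrier}
    (hv : G.IsLowering v) (m : M) {i : Fin D} (hi : p i = 0) : β.repr (A v m) i = 0 := by
  rw [← LinearMap.toMatrix_mulVec_repr β β, Matrix.mulVec, dotProduct]
  refine Finset.sum_eq_zero fun j _ => ?_
  have h := apply_eq_zero_of_comm (s := -1) (i := i) (j := j) (isAction_toMatrix β hA) hY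
    ((G.commY_lowering hv).trans (neg_one_smul ℂ v).symm) (fun e => by
      rw [hi, Nat.cast_zero, zero_add] at e
      have : ((p j + 1 : ℕ) : ℂ) = 0 := by push_cast; rw [e]; ring
      exact absurd this (Nat.cast_ne_zero.2 (Nat.succ_ne_zero _)))
  change LinearMap.toMatrix β β (A v) i j = 0 at h
  rw [h, zero_mul]

theorem repr_top (hA : G.IsModelAct L low top y A)
    (hY : LinearMap.toMatrix β β (A G.Y) = Matrix.diagonal fun j => y - p j) (l : L) {j : Fin D}
    (hj : p j ≠ 0) : β.repr (top l) j = 0 := by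
  have h := repr_Y hY (top l) j
  rw [Y_top hA, map_smul, Finsupp.smul_apply, smul_eq_mul] at h
  have h' : (p j : ℂ) * β.repr (top l) j = 0 := by linear_combination h
  exact (mul_eq_zero.1 h').resolve_left (Nat.cast_ne_zero.2 hj)

/-- The vectors of highest hypercharge are those of `L`. -/
theorem exists_top_eq (free : IsFree low top) (hA : G.IsModelAct L low top y A)
    (hY : LinearMap.toMatrix β β (A G.Y) = Matrix.diagonal fun j => y - p j) {m : M}
    (hm : ∀ j, p j ≠ 0 → β.repr m j = 0) : ∃ l, top l = m := by
  -- The span of the basis vectors with `p ≠ 0`. It contains every image of a lowering operator, so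
  -- together with `L` it fills `M`.
  let K : Submodule ℂ M :=
    { carrier := {m | ∀ i, p i = 0 → β.repr m i = 0}
      add_mem' := fun ha hb i hi => by simp [ha i hi, hb i hi]
      zero_mem' := fun i _ => by simp
      smul_mem' := fun c a ha i hi => by simp [ha i hi] }
  have h : LinearMap.range top ⊔ K = ⊤ := free.eq_top _
    (fun l => Submodule.mem_sup_left ⟨l, rfl⟩) fun v m _ => Submodule.mem_sup_right fun i hi => by
      rw [← hA.low_eq]
      exact repr_lowering (hA.isAction free) hY (G.isLowering_of_lowering v) m hi
  obtain ⟨_, ⟨l, rfl⟩, k, hk, rfl⟩ := Submodule.mem_sup.1 (h ▸ Submodule.mem_top : m ∈ _)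
  refine ⟨l, ?_⟩
  have : k = 0 := β.ext_elem fun j => by
    rw [map_zero, Finsupp.zero_apply]
    by_cases hj : p j = 0
    · exact hk j hj
    · have := hm j hj
      rwa [map_add, Finsupp.add_apply, repr_top hA hY l hj, zero_add] at this
  rw [this, add_zero]

variable {N : ℕ} {lam : Fin (N - 1) → ℂ}

/-- The projection of an invariant subspace to the vectors of highest hypercharge. -/
theorem exists_highest (hY : LinearMap.toMatrix β β (A G.Y) = Matrix.diagonal fun j => y - p j)
    (W : Submodule ℂ (Fin N → M)) (hW : ∀ f ∈ W, (fun k => A G.Y (f k)) + shift lam f ∈ W)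
    {last : Fin N} (hlast : last.val + 1 = N) {j₀ : Fin D} (hj₀ : p j₀ = 0) {f₀ : Fin N → M}
    (hf₀ : f₀ ∈ W) (hne : β.repr (f₀ last) j₀ ≠ 0) (s : Finset ℕ) (hs : 0 ∉ s) :
    ∃ f ∈ W, β.repr (f last) j₀ ≠ 0 ∧ ∀ k j, p j ∈ s → β.repr (f k) j = 0 := by
  induction s using Finset.induction_on with
  | empty => exact ⟨f₀, hf₀, hne, fun k j h => absurd h (Finset.notMem_empty _)⟩
  | insert q s hq ih =>
    rw [Finset.mem_insert, not_or] at hs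
    obtain ⟨f, hf, h1, h2⟩ := ih hs.2
    -- Each application of `Y - (y - q)` clears level `q` in one more block, from the last block
    -- backwards, so `N` applications suffice. Levels already cleared stay clear, and the coordinate
    -- `j₀` of the last block is multiplied by `q ≠ 0`.
    have step : ∀ n : ℕ, ∃ g ∈ W, β.repr (g last) j₀ ≠ 0 ∧
        (∀ k j, p j ∈ s → β.repr (g k) j = 0) ∧
        ∀ (k : Fin N) j, p j = q → N ≤ k.val + n → β.repr (g k) j = 0 := by
      intro n
      induction n with
      | zero => exact ⟨f, hf, h1, h2, fun k j _ hk => absurd k.isLt (by omega)⟩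
      | succ n ih =>
        obtain ⟨g, hg, g1, g2, g3⟩ := ih
        have repr_eq : ∀ k j, β.repr (((fun k => A G.Y (g k)) + shift lam g
            - (y - (q : ℂ)) • g) k) j
            = ((q : ℂ) - p j) * β.repr (g k) j + β.repr (shift lam g k) j := fun k j => by
          simp only [Pi.sub_apply, Pi.add_apply, Pi.smul_apply, map_sub, map_add, map_smul,
            Finsupp.sub_apply, Finsupp.add_apply, Finsupp.smul_apply, smul_eq_mul, repr_Y hY]
          ring
        have shift_eq : ∀ (k : Fin N) j,
            (∀ h : k.val + 1 < N, β.repr (g ⟨k.val + 1, h⟩) j = 0) →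
            β.repr (shift lam g k) j = 0 := fun k j hk => by
          rw [shift]
          split_ifs with h
          · rw [map_smul, Finsupp.smul_apply, hk h, smul_zero]
          · simp
        refine ⟨_, W.sub_mem (hW g hg) (W.smul_mem (y - (q : ℂ)) hg), ?_, fun k j hj => ?_,
          fun k j hj hk => ?_⟩
        · rw [repr_eq, hj₀, shift_eq _ _ (fun h => absurd h (by omega)), add_zero, Nat.cast_zero,
            sub_zero]
          exact mul_ne_zero (Nat.cast_ne_zero.2 (Ne.symm hs.1)) g1
        · rw [repr_eq, g2 k j hj, shift_eq _ _ (fun h => g2 _ j hj), mul_zero, add_zero]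
        · rw [repr_eq, hj, sub_self, zero_mul, zero_add,
            shift_eq _ _ (fun h => g3 _ j hj (by simp only; omega))]
    obtain ⟨g, hg, g1, g2, g3⟩ := step N
    refine ⟨g, hg, g1, fun k j hj => ?_⟩
    rcases Finset.mem_insert.1 hj with e | e
    · exact g3 k j e (by omega)
    · exact g2 k j e

/-- Clearing all levels `p ≠ 0` puts a vector of `W` into `L^N` with nonzero last entry. Then `W`
contains `L^N` by `eq_top_of_shift_mem`, and freeness spreads each copy of `L` to a copy of `M`. -/
theorem invariant_eq_top [LieModule.IsIrreducible ℂ G.ss L] (free : IsFree low top)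
    (hA : G.IsModelAct L low top y A)
    (hY : LinearMap.toMatrix β β (A G.Y) = Matrix.diagonal fun j => y - p j)
    (hlam : ∀ i, lam i ≠ 0) (W : Submodule ℂ (Fin N → M))
    (hWY : ∀ f ∈ W, (fun k => A G.Y (f k)) + shift lam f ∈ W)
    (hWss : ∀ x : G.ss, ∀ f ∈ W, (fun k => A (G.ofSS x) (f k)) ∈ W)
    (hWlow : ∀ v, G.IsLowering v → ∀ f ∈ W, (fun k => A v (f k)) ∈ W)
    {last : Fin N} (hlast : last.val + 1 = N) {j₀ : Fin D} (hj₀ : p j₀ = 0) {f₀ : Fin N → M}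
    (hf₀ : f₀ ∈ W) (hne : β.repr (f₀ last) j₀ ≠ 0) : W = ⊤ := by
  obtain ⟨f, hf, h1, h2⟩ := exists_highest hY W hWY hlast hj₀ hf₀ hne
    ((Finset.univ.image p).erase 0) (Finset.notMem_erase _ _)
  choose l hl using fun k => exists_top_eq free hA hY (m := f k) fun j hj =>
    h2 k j (Finset.mem_erase.2 ⟨hj, Finset.mem_image_of_mem p (Finset.mem_univ j)⟩)
  have hP : W.comap (top.compLeft (Fin N)) = ⊤ := by
    refine eq_top_of_shift_mem (G := G) hlam _ (fun x g hg => ?_) (fun g hg => ?_) hlast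
      (f₀ := l) ?_ ?_
    · have := hWss x _ hg
      rw [Submodule.mem_comap]
      convert this using 1
      funext k
      exact (ss_top hA x (g k)).symm
    -- On `L^N` the hypercharge acts as `y` plus the shift, so `Y - y` is the shift.
    · have := W.sub_mem (hWY _ hg) (W.smul_mem y hg)
      rw [Submodule.mem_comap]
      convert this using 1
      funext k
      have e : A G.Y (top (g k)) = y • top (g k) := Y_top hA _
      change top (shift lam g k)
        = (A G.Y (top (g k)) + shift lam (fun i => top (g i)) k) - y • top (g k)
      rw [e, add_sub_cancel_left, shift, shift]
      split_ifs with h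
      · rw [map_smul]
      · rw [map_zero]
    · rw [Submodule.mem_comap]
      convert hf using 1
      exact funext hl
    · intro h0
      rw [← hl, h0, map_zero, map_zero] at h1
      exact h1 rfl
  have hsingle : ∀ k, W.comap (LinearMap.single ℂ (fun _ => M) k) = ⊤ := fun k => by
    refine free.eq_top _ (fun l => ?_) fun v m hm => ?_
    · have : Pi.single k l ∈ W.comap (top.compLeft (Fin N)) := hP ▸ Submodule.mem_top
      rw [Submodule.mem_comap] at this ⊢
      convert this using 1
      funext i
      change (Pi.single k (top l) : Fin N → M) i = top ((Pi.single k l : Fin N → L) i)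
      by_cases h : i = k
      · subst h
        simp
      · simp [h]
    · have := hWlow v (G.isLowering_of_lowering v) _ hm
      rw [Submodule.mem_comap, ← hA.low_eq]
      convert this using 1
      funext i
      change (Pi.single k (A v m) : Fin N → M) i = A v ((Pi.single k m : Fin N → M) i)
      by_cases h : i = k
      · subst h
        simp
      · simp [h]
  rw [eq_top_iff]
  intro g _
  rw [← Finset.univ_sum_single g]
  refine W.sum_mem fun k _ => ?_
  have : g k ∈ W.comap (LinearMap.single ℂ (fun _ => M) k) := hsingle k ▸ Submodule.mem_top
  exact this

/-- The unit vector at `(last, j₀)` splits between the two summands, so one of them has a vector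
with nonzero coordinate there. By `invariant_eq_top` that summand is everything and the other is
zero. -/
theorem isIndecomposable_nestMap [LieModule.IsIrreducible ℂ G.ss L] (free : IsFree low top)
    (hA : G.IsModelAct L low top y A)
    (hY : LinearMap.toMatrix β β (A G.Y) = Matrix.diagonal fun j => y - p j)
    {B : G.carrier →ₗ[ℂ] Matrix (Fin D) (Fin D) ℂ} (hBss : ∀ x : G.ss, B (G.ofSS x) = 0)
    (hBY : B G.Y = 1) (hBlow : ∀ v, G.IsLowering v → B v = 0) {Λ : L} (hΛ : Λ ≠ 0)
    (hN : 1 ≤ N) (hlam : ∀ i, lam i ≠ 0) :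
    G.IsIndecomposable (nestMap lam ((LinearMap.toMatrix β β).toLinearMap ∘ₗ A) B) := by
  let last : Fin N := ⟨N - 1, by omega⟩
  have hlast : last.val + 1 = N := by simp only [last]; omega
  -- Otherwise all coordinates of `top Λ` would vanish, against injectivity of `top`.
  obtain ⟨j₀, hj₀⟩ : ∃ j₀, p j₀ = 0 := by
    by_contra! h
    refine hΛ (free.top_injective ?_)
    rw [map_zero]
    exact β.ext_elem fun j => by rw [repr_top hA hY Λ (h j), map_zero, Finsupp.zero_apply]
  let E : (Fin N → M) →ₗ[ℂ] (Fin N × Fin D → ℂ) :=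
    { toFun := fun f q => β.repr (f q.1) q.2
      map_add' := fun f g => funext fun q => by simp
      map_smul' := fun c f => funext fun q => by simp }
  have hE : ∀ x f, (nestMap lam ((LinearMap.toMatrix β β).toLinearMap ∘ₗ A) B x).mulVec (E f)
      = fun q : Fin N × Fin D => β.repr (A x (f q.1)) q.2 +
        if h : q.1.val + 1 < N then lam ⟨q.1.val, by omega⟩ *
          (B x).mulVec (β.repr (f ⟨q.1.val + 1, h⟩)) q.2 else 0 := fun x f => by
    funext ⟨k, i⟩
    change (nest lam (LinearMap.toMatrix β β (A x)) (B x)).mulVec (E f) (k, i) = _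
    rw [nest_mulVec]
    congr 1
    exact congrFun (LinearMap.toMatrix_mulVec_repr β β (A x) (f k)) i
  have key : ∀ W : Submodule ℂ (Fin N × Fin D → ℂ),
      G.IsInvariant (nestMap lam ((LinearMap.toMatrix β β).toLinearMap ∘ₗ A) B) W →
      ∀ w ∈ W, w (last, j₀) ≠ 0 → W = ⊤ := by
    intro W hW w hw hne
    have hEsurj : ∀ w, ∃ f, E f = w := fun w =>
      ⟨fun k => β.equivFun.symm fun j => w (k, j), funext fun q => by
        change β.repr (β.equivFun.symm fun j => w (q.1, j)) q.2 = w q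
        rw [← Module.Basis.equivFun_apply, LinearEquiv.apply_symm_apply]⟩
    have h0 : ∀ x, B x = 0 → ∀ f ∈ W.comap E, (fun k => A x (f k)) ∈ W.comap E := by
      intro x hx f hf
      have := hW x _ hf
      rw [hE] at this
      rw [Submodule.mem_comap]
      convert this using 1
      funext q
      simp [hx, E]
    obtain ⟨f₀, rfl⟩ := hEsurj w
    have htop : W.comap E = ⊤ := by
      refine invariant_eq_top free hA hY hlam _ (fun f hf => ?_) (fun x => h0 _ (hBss x))
        (fun v hv => h0 _ (hBlow v hv)) hlast hj₀ (f₀ := f₀) hw hne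
      have := hW G.Y _ hf
      rw [hE] at this
      rw [Submodule.mem_comap]
      convert this using 1
      funext q
      change β.repr (A G.Y (f q.1) + shift lam f q.1) q.2 = _
      rw [map_add, Finsupp.add_apply, shift, hBY]
      congr 1
      split_ifs with h
      · rw [Matrix.one_mulVec, map_smul, Finsupp.smul_apply, smul_eq_mul]
      · simp
    rw [eq_top_iff]
    intro w _
    obtain ⟨f, rfl⟩ := hEsurj w
    have : f ∈ W.comap E := htop ▸ Submodule.mem_top
    exact this
  refine ⟨⟨(last, j₀)⟩, fun W₁ W₂ h₁ h₂ hc => ?_⟩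
  obtain ⟨w₁, hw₁, w₂, hw₂, hsum⟩ := Submodule.mem_sup.1
    (hc.sup_eq_top ▸ Submodule.mem_top : (Pi.single (last, j₀) 1 : Fin N × Fin D → ℂ) ∈ W₁ ⊔ W₂)
  have hne : w₁ (last, j₀) + w₂ (last, j₀) ≠ 0 := by
    have := congrFun hsum (last, j₀)
    rw [Pi.add_apply, Pi.single_eq_same] at this
    rw [this]
    exact one_ne_zero
  by_cases e : w₁ (last, j₀) = 0
  · left
    rw [e, zero_add] at hne
    have := hc.inf_eq_bot
    rwa [key W₂ h₂ w₂ hw₂ hne, inf_top_eq] at this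
  · right
    have := hc.inf_eq_bot
    rwa [key W₁ h₁ w₁ hw₁ e, top_inf_eq] at this

end indecomposable

end HyperSuperalgebra

end Matryoshka

/-! ### The matryoshka theorem -/

theorem mainTheorem1 (G : Matryoshka.HyperSuperalgebra) (hG : Matryoshka.IsTypeI G)
    {L : Type*} [AddCommGroup L] [Module ℂ L] [LieRingModule G.ss L] [LieModule ℂ G.ss L]
    [FiniteDimensional ℂ L] [LieModule.IsIrreducible ℂ G.ss L] (Λ : L) (hΛ : Λ ≠ 0) :
    -- a basis of homogeneous lowering polynomials applied to `Λ`, the same for all `y`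
    (∃ (D : ℕ) (c : Fin D → G.Env) (p : Fin D → ℕ)
      (b : (y : ℂ) → Module.Basis (Fin D) ℂ (G.Kac L y)),
      (∀ j, c j ∈ G.lowerEnv) ∧
      (∀ j, G.env G.Y * c j - c j * G.env G.Y = -(p j : ℂ) • c j) ∧
      ∀ y j, b y j = c j • G.top L y Λ) ∧
    -- the matrices of the Kac modules in any such basis
    ∀ (D : ℕ) (c : Fin D → G.Env) (p : Fin D → ℕ)
      (b : (y : ℂ) → Module.Basis (Fin D) ℂ (G.Kac L y)),
      (∀ j, c j ∈ G.lowerEnv) →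
      (∀ j, G.env G.Y * c j - c j * G.env G.Y = -(p j : ℂ) • c j) →
      (∀ y j, b y j = c j • G.top L y Λ) →
      -- the derivative with respect to the hypercharge
      ∃ ρ' : G.carrier →ₗ[ℂ] Matrix (Fin D) (Fin D) ℂ,
        (∀ x y i j, HasDerivAt (fun z => G.kacMatrix L z (b z) x i j) (ρ' x i j) y) ∧
        (∀ x : G.ss, ρ' (G.ofSS x) = 0) ∧ ρ' G.Y = 1 ∧ (∀ v, G.IsLowering v → ρ' v = 0) ∧
        ∀ (y : ℂ) (N : ℕ), 1 ≤ N →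
          -- dimension `N * D`
          Module.finrank ℂ (Fin N × Fin D → ℂ) = N * Module.finrank ℂ (G.Kac L y) ∧
          (∀ lam : Fin (N - 1) → ℂ,
            -- the block matrices `(M, Y, U, V)` satisfy the relations of the superalgebra
            G.IsRep (fun q : Fin N × Fin D => (p q.2 : ZMod 2))
              (Matryoshka.nestMap lam (G.kacMatrix L y (b y)) ρ') ∧
            -- `N` nested copies of the Kac module
            (∀ k : Fin N, ∃ π : (Fin N × Fin D → ℂ) →ₗ[ℂ] G.Kac L y,
              (Matryoshka.flag N D (k + 1)).map π = ⊤ ∧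
              Matryoshka.flag N D (k + 1) ⊓ LinearMap.ker π = Matryoshka.flag N D k ∧
              ∀ x, ∀ w ∈ Matryoshka.flag N D (k + 1),
                (Matryoshka.nestMap lam (G.kacMatrix L y (b y)) ρ' x).mulVec w ∈
                  Matryoshka.flag N D (k + 1) ∧
                π ((Matryoshka.nestMap lam (G.kacMatrix L y (b y)) ρ' x).mulVec w) =
                  G.act L y x (π w)) ∧
            -- indecomposability
            ((∀ i, lam i ≠ 0) →
              G.IsIndecomposable (Matryoshka.nestMap lam (G.kacMatrix L y (b y)) ρ'))) ∧
          -- free rescaling of the extension parameters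
          ∀ lam lam' : Fin (N - 1) → ℂ, (∀ i, lam i ≠ 0) → (∀ i, lam' i ≠ 0) →
            ∃ s : Fin N → ℂ, (∀ i, s i ≠ 0) ∧ ∀ x,
              Matrix.diagonal (fun q : Fin N × Fin D => s q.1) *
                  Matryoshka.nestMap lam (G.kacMatrix L y (b y)) ρ' x *
                  Matrix.diagonal (fun q : Fin N × Fin D => (s q.1)⁻¹) =
                Matryoshka.nestMap lam' (G.kacMatrix L y (b y)) ρ' x := by
  obtain ⟨M, _, _, _, low, top, free⟩ := Matryoshka.exists_isFree G.lowering L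
  obtain ⟨A₀, h0⟩ := G.exists_isModelAct L free 0
  obtain ⟨A₁, h1⟩ := G.exists_isModelAct L free 1
  -- The actions at the parameters `0` and `1` determine the whole family.
  have hA := fun y => h0.affine h1 y
  refine ⟨Matryoshka.HyperSuperalgebra.exists_homogeneous_basis free hA hΛ,
    fun D c p b hc hp hb => ?_⟩
  obtain ⟨β, hβ⟩ := Matryoshka.HyperSuperalgebra.exists_common_basis free hA hc hb
  let ρ₀ := (LinearMap.toMatrix β β).toLinearMap ∘ₗ A₀
  let ρ' := (LinearMap.toMatrix β β).toLinearMap ∘ₗ (A₁ - A₀)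
  have hρA : ∀ y : ℂ,
      ρ₀ + y • ρ' = (LinearMap.toMatrix β β).toLinearMap ∘ₗ (A₀ + y • (A₁ - A₀)) := fun y =>
    LinearMap.ext fun x => by
      change LinearMap.toMatrix β β (A₀ x) + y • LinearMap.toMatrix β β ((A₁ - A₀) x)
        = LinearMap.toMatrix β β (A₀ x + y • (A₁ - A₀) x)
      rw [map_add, map_smul]
  have hρ : ∀ y : ℂ, G.kacMatrix L y (b y) = ρ₀ + y • ρ' := fun y => by
    rw [hρA]
    exact LinearMap.ext (hβ y)
  have hY : ∀ y : ℂ, (ρ₀ + y • ρ') G.Y = Matrix.diagonal fun j => y - (p j : ℂ) := fun y => by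
    rw [← hρ]
    exact Matryoshka.HyperSuperalgebra.kacMatrix_Y hp (hb y)
  have hact : ∀ y : ℂ, Matryoshka.HyperSuperalgebra.IsAction (ρ₀ + y • ρ') := fun y => by
    rw [hρA]
    exact Matryoshka.HyperSuperalgebra.isAction_toMatrix β ((hA y).isAction free)
  have hss : ∀ x : G.ss, ρ' (G.ofSS x) = 0 := fun x => by
    change LinearMap.toMatrix β β (A₁ (G.ofSS x) - A₀ (G.ofSS x)) = 0
    rw [Matryoshka.HyperSuperalgebra.ss_eq free h1 h0, sub_self, map_zero]
  have hlow : ∀ v, G.IsLowering v → ρ' v = 0 := fun v hv => by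
    change LinearMap.toMatrix β β ((A₁ - A₀) v) = 0
    rw [h0.sub_lowering h1 hv, map_zero]
  have hY' : ρ' G.Y = 1 := by
    -- The slope is the difference of the diagonal matrices at `y = 1` and `y = 0`, in which the `p
    -- j` cancel.
    have e : ρ' G.Y = (ρ₀ + (1 : ℂ) • ρ') G.Y - (ρ₀ + (0 : ℂ) • ρ') G.Y := by simp
    rw [e, hY, hY, Matrix.diagonal_sub, ← Matrix.diagonal_one]
    congr 1
    funext j
    ring
  have hderiv : ∀ x y i j, HasDerivAt (fun z => G.kacMatrix L z (b z) x i j) (ρ' x i j) y := by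
    intro x y i j
    have e : (fun z => G.kacMatrix L z (b z) x i j) = fun z => ρ₀ x i j + z * ρ' x i j := by
      funext z
      rw [hρ]
      rfl
    rw [e]
    simpa using ((hasDerivAt_id y).mul_const (ρ' x i j)).const_add (ρ₀ x i j)
  refine ⟨ρ', hderiv, hss, hY', hlow, fun y N hN => ⟨?_, fun lam => ⟨?_, fun k => ?_,
    fun hlam => ?_⟩, fun lam lam' hlam hlam' => ?_⟩⟩
  · rw [Module.finrank_eq_card_basis (b y)]
    simp
  · rw [hρ]
    exact Matryoshka.HyperSuperalgebra.isRep_nestMap hact hY y lam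
  · obtain ⟨π, h1, h2, h3⟩ := Matryoshka.exists_flag_quotient (b y) k
    exact ⟨π, h1, h2, fun x w hw => h3 lam (G.act L y x) (ρ' x) w hw⟩
  · rw [hρ, hρA]
    refine Matryoshka.HyperSuperalgebra.isIndecomposable_nestMap (p := p) free (hA y) ?_ hss hY'
      hlow hΛ hN hlam
    rw [← hY y, hρA]
    rfl
  · obtain ⟨s, hs, h⟩ := Matryoshka.exists_rescaling (D := D) lam lam' hlam hlam'
    exact ⟨s, hs, fun x => h _ _⟩
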